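/- Let $F$ be one of the five non-Gaussian natural exponential families with quadratic variance function $V(\theta)=\nu_0+\nu_1\theta+\nu_2\theta^2$, and let $Y_1,Y_2,\dots$ be independent random variables with $E Y_i=\theta_i$, $\operatorname{Var}Y_i=V(\theta_i)/\tau_i$, all from $F$, where $(\tau_i)$, $(\theta_i)$ are fixed sequences, $\tau_i>0$ is known, and one of the following holds (together with the listed conditions): 1. Binomial: $Y_i\sim \mathrm{Bin}(n_i,p_i)/n_i$ with $n_i$ an integer, $0\le p_i\le 1$; $\tau_i=n_i$, $\theta_i=p_i$, $(\nu_0,\nu_1,\nu_2)=(0,1,-1)$, $\Theta=[0,1]$; $n_i\ge 2$ for all $i$. 2. Poisson: $Y_i\sim \mathrm{Poisson}(\tau_i\theta_i)/\tau_i$ with $\theta_i>0$; $(0,1,0)$, $\Theta=[0,\infty)$; $\inf_i\tau_i>0$, $\inf_i\tau_i\theta_i>0$ and $\sum_{i\le p}\theta_i^3=O(p)$. 3. Negative binomial: $Y_i\sim \mathrm{NBin}(n_i,p_i)/n_i$ with real $n_i>0$, $0<p_i<1$, where $\mathrm{NBin}(n,q)$ has mass $\frac{\Gamma(k+n)}{k!\,\Gamma(n)}q^k(1-q)^n$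 at $k=0,1,2,\dots$; $\tau_i=n_i$, $\theta_i=p_i/(1-p_i)$, $(0,1,1)$, $\Theta=[0,\infty)$; $\inf_i n_ip_i>0$ and $\sum_{i\le p}(p_i/(1-p_i))^4=O(p)$. 4. Gamma: $Y_i\sim\Gamma(\tau_i\alpha,\lambda_i)/\tau_i$ (shape $\tau_i\alpha$, scale $\lambda_i>0$) with a fixed $\alpha>0$; $\theta_i=\alpha\lambda_i$, $(0,0,1/\alpha)$, $\Theta=[0,\infty)$; $\inf_i\tau_i>0$ and $\sum_{i\le p}\lambda_i^4=O(p)$. 5. Generalized hyperbolic secant: $Y_i\sim \mathrm{GHS}(\tau_i\alpha,\lambda_i)/\tau_i$ with a fixed $\alpha>0$ and $\lambda_i\in\mathbb R$; $\theta_i=\alpha\lambda_i$, $(\alpha,0,1/\alpha)$, $\Theta=\mathbb R$; $\inf_i\tau_i>0$ and $\sum_{i\le p}\lambda_i^4=O(p)$. Here $\mathrm{GHS}(r,\lambda)$ is the law with density proportional to $e^{x\arctan\lambda}$ with respect to the probability measure whose moment generating function is $(\cos t)^{-r}$ for $|t|<\pi/2$. For $0\le\gamma\le\infty$ and $\mu\in\mathbb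 R$ put $\hat\theta_i^{\gamma,\mu}=\frac{\tau_i}{\tau_i+\gamma}Y_i+\frac{\gamma}{\tau_i+\gamma}\mu$ (with weights $0$ and $1$ for $\gamma=\infty$), let $l_p(\theta,\hat\theta)=\frac1p\sum_{i=1}^p(\hat\theta_i-\theta_i)^2$ and $R_p(\theta,\hat\theta)=E[l_p(\theta,\hat\theta)]$, and let $$\mathrm{URE}^P(\gamma,\mu)=\frac1p\sum_{i=1}^p\Bigl[\frac{\gamma^2}{(\tau_i+\gamma)^2}(Y_i-\mu)^2+\frac{\tau_i-\gamma}{\tau_i+\gamma}\cdot\frac{V(Y_i)}{\tau_i+\nu_2}\Bigr].$$ For every $p\ge1$ let $(\hat\gamma^{PM},\hat\mu^{PM})$ be a (measurable) minimizer of $\mathrm{URE}^P$ over $\{0\le\gamma\le\infty,\ |\mu|\le\max_{i\le p}|Y_i|,\ \mu\in\Theta\}$, and let $\hat\theta^{PM}=\hat\theta^{\hat\gamma^{PM},\hat\mu^{PM}}$ be the parametric URE estimator. Then for any (random, measurable) $\hat\gamma=\hat\gamma_p\in[0,\infty]$ and $\hat\mu=\hat\mu_p$ with $|\hat\mu|\le\max_{i\le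 p}|Y_i|$, all the losses below are integrable, $$\lim_{p\to\infty}P\bigl(l_p(\theta,\hat\theta^{PM})\ge l_p(\theta,\hat\theta^{\hat\gamma,\hat\mu})+\varepsilon\bigr)=0\quad\text{for every }\varepsilon>0,$$ and $$\limsup_{p\to\infty}\bigl[R_p(\theta,\hat\theta^{PM})-R_p(\theta,\hat\theta^{\hat\gamma,\hat\mu})\bigr]\le0.$$ -/

import Mathlib

open MeasureTheory ProbabilityTheory Filter Topology
open scoped ENNReal NNReal

noncomputable section

namespace NEFQVF

/-! ### Distributions -/

/-- The negative binomial law on `ℕ` with convolution parameter `r > 0` and success probability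
`q`: the mass at `k` is `Γ(k + r) / (k! Γ(r)) * q ^ k * (1 - q) ^ r`.  For integral `r` it is the
law of the number of successes before the `r`-th failure. -/
def negBinomialMeasure (r q : ℝ) : Measure ℕ :=
  Measure.sum fun k : ℕ =>
    ENNReal.ofReal
      (Real.Gamma (k + r) / (k.factorial * Real.Gamma r) * q ^ k * (1 - q) ^ r) •
      Measure.dirac k

/-- The symmetric generalized hyperbolic secant law with convolution parameter `r`: the
probability measure whose moment generating function is `(sec t) ^ r` on `(-π/2, π/2)`
(this determines the measure; for `r = 1` it has density `1 / (2 cosh (π x / 2))`). -/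
def IsSymmetricGHS (r : ℝ) (ν : Measure ℝ) : Prop :=
  IsProbabilityMeasure ν ∧
    ∀ t : ℝ, |t| < Real.pi / 2 → mgf id ν t = (Real.cos t) ^ (-r)

/-- `G` is the law `GHS(r, l)`: the member with mean `r * l` of the natural exponential family
generated by the symmetric law, i.e. its exponential tilt with natural parameter `arctan l`. -/
def IsGHS (r l : ℝ) (G : Measure ℝ) : Prop :=
  ∃ ν : Measure ℝ, IsSymmetricGHS r ν ∧ G = ν.tilted fun x => Real.arctan l * x

/-- The five non-Gaussian natural exponential families with quadratic variance function.  The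
Gamma and GHS families carry the known constant `α` of their shape parameter. -/
inductive Family : Type
  | binomial : Family
  | poisson : Family
  | negBinomial : Family
  | gamma (α : ℝ) : Family
  | ghs (α : ℝ) : Family

namespace Family

/-- The coefficient `ν₀` of the variance function. -/
def nu0 : Family → ℝ
  | binomial => 0
  | poisson => 0
  | negBinomial => 0
  | gamma _ => 0
  | ghs α => α

/-- The coefficient `ν₁` of the variance function. -/
def nu1 : Family → ℝ
  | binomial => 1
  | poisson => 1
  | negBinomial => 1
  | gamma _ => 0
  | ghs _ => 0

/-- The coefficient `ν₂` of the variance function. -/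
def nu2 : Family → ℝ
  | binomial => -1
  | poisson => 0
  | negBinomial => 1
  | gamma α => 1 / α
  | ghs α => 1 / α

/-- The variance function `V(y) = ν₀ + ν₁ y + ν₂ y²`. -/
def V (F : Family) (y : ℝ) : ℝ := F.nu0 + F.nu1 * y + F.nu2 * y ^ 2

/-- The mean `θ` as a function of the parameter `η` of the family, where `η` is the success
probability (binomial, negative binomial), the mean itself (Poisson), or the scale
(Gamma, GHS). -/
def mean : Family → ℝ → ℝ
  | binomial, η => η
  | poisson, η => η
  | negBinomial, η => η / (1 - η)
  | gamma α, η => α * η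
  | ghs α, η => α * η

/-- The mean parameter space `Θ`, taken closed, so that minima over `Θ` are attained. -/
def meanSpace : Family → Set ℝ
  | binomial => Set.Icc 0 1
  | poisson => Set.Ici 0
  | negBinomial => Set.Ici 0
  | gamma _ => Set.Ici 0
  | ghs _ => Set.univ

/-- `F.IsLaw τ η Q`: the pair `(τ, η)` lies in the parameter range of the family, and `Q` is the
law of an observation `Y` with convolution parameter `τ` and parameter `η`. -/
def IsLaw : Family → ℝ → ℝ → Measure ℝ → Prop
  | binomial, τ, η, Q =>
      ∃ (n : ℕ) (q : unitInterval), 0 < n ∧ τ = n ∧ η = q ∧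
        Q = (ProbabilityTheory.binomial n q).map fun k : ℕ => (k : ℝ) / τ
  | poisson, τ, η, Q =>
      0 < τ ∧ 0 < η ∧ Q = (poissonMeasure (τ * η).toNNReal).map fun k : ℕ => (k : ℝ) / τ
  | negBinomial, τ, η, Q =>
      0 < τ ∧ 0 < η ∧ η < 1 ∧ Q = (negBinomialMeasure τ η).map fun k : ℕ => (k : ℝ) / τ
  | gamma α, τ, η, Q =>
      0 < α ∧ 0 < τ ∧ 0 < η ∧ Q = (gammaMeasure (τ * α) (1 / η)).map fun x : ℝ => x / τ
  | ghs α, τ, η, Q =>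
      0 < α ∧ 0 < τ ∧ ∃ G : Measure ℝ, IsGHS (τ * α) η G ∧ Q = G.map fun x : ℝ => x / τ

/-- The regularity conditions on the parameter sequences, family by family. -/
def Conditions : Family → (ℕ → ℝ) → (ℕ → ℝ) → Prop
  | binomial, τ, _ => ∀ i, 2 ≤ τ i
  | poisson, τ, η =>
      (∃ c > 0, ∀ i, c ≤ τ i) ∧ (∃ c > 0, ∀ i, c ≤ τ i * η i) ∧
        (fun p : ℕ => ∑ i ∈ Finset.range p, η i ^ 3) =O[atTop] fun p : ℕ => (p : ℝ)
  | negBinomial, τ, η =>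
      (∃ c > 0, ∀ i, c ≤ τ i * η i) ∧
        (fun p : ℕ => ∑ i ∈ Finset.range p, (η i / (1 - η i)) ^ 4) =O[atTop] fun p : ℕ => (p : ℝ)
  | gamma _, τ, η =>
      (∃ c > 0, ∀ i, c ≤ τ i) ∧
        (fun p : ℕ => ∑ i ∈ Finset.range p, η i ^ 4) =O[atTop] fun p : ℕ => (p : ℝ)
  | ghs _, τ, η =>
      (∃ c > 0, ∀ i, c ≤ τ i) ∧
        (fun p : ℕ => ∑ i ∈ Finset.range p, η i ^ 4) =O[atTop] fun p : ℕ => (p : ℝ)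

end Family

/-! ### Shrinkage estimators, loss and unbiased risk estimate

Sequences are indexed from `0`; the first `p` observations are those with index `i < p`. -/

/-- The weight `τ / (τ + γ)` of the observation, `γ ∈ [0, ∞]`. -/
def dataWeight (τ : ℝ) (γ : ℝ≥0∞) : ℝ := if γ = ⊤ then 0 else τ / (τ + γ.toReal)

/-- The weight `γ / (τ + γ)` of the location, `γ ∈ [0, ∞]`. -/
def shrinkWeight (τ : ℝ) (γ : ℝ≥0∞) : ℝ := if γ = ⊤ then 1 else γ.toReal / (τ + γ.toReal)

/-- The shrinkage estimate `τ / (τ + γ) * y + γ / (τ + γ) * μ` of one coordinate. -/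
def estimate (γ : ℝ≥0∞) (μ τ y : ℝ) : ℝ := dataWeight τ γ * y + shrinkWeight τ γ * μ

/-- The loss `(1/p) ∑ (θ̂ᵢ - θᵢ)²` of the shrinkage estimator with parameters `(γ, μ)`. -/
def loss (p : ℕ) (θ τ y : ℕ → ℝ) (γ : ℝ≥0∞) (μ : ℝ) : ℝ :=
  1 / (p : ℝ) * ∑ i ∈ Finset.range p, (estimate γ μ (τ i) (y i) - θ i) ^ 2

/-- `max_{i < p} |yᵢ|` (for `0 < p`). -/
def maxAbs (p : ℕ) (y : ℕ → ℝ) : ℝ := ⨆ i : Fin p, |y i|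

/-- The parametric unbiased risk estimate; note
`dataWeight τ γ - shrinkWeight τ γ = (τ - γ) / (τ + γ)`. -/
def URE (F : Family) (p : ℕ) (τ y : ℕ → ℝ) (γ : ℝ≥0∞) (μ : ℝ) : ℝ :=
  1 / (p : ℝ) * ∑ i ∈ Finset.range p,
    (shrinkWeight (τ i) γ ^ 2 * (y i - μ) ^ 2 +
      (dataWeight (τ i) γ - shrinkWeight (τ i) γ) * (F.V (y i) / (τ i + F.nu2)))

/-- The set `{(γ, μ) : 0 ≤ γ ≤ ∞, |μ| ≤ max |yᵢ|, μ ∈ Θ}`. -/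
def searchSet (F : Family) (p : ℕ) (y : ℕ → ℝ) : Set (ℝ≥0∞ × ℝ) :=
  {q | |q.2| ≤ maxAbs p y ∧ q.2 ∈ F.meanSpace}

/-- `(γ, μ)` minimizes the unbiased risk estimate over the search set. -/
def IsUREMinimizer (F : Family) (p : ℕ) (τ y : ℕ → ℝ) (γ : ℝ≥0∞) (μ : ℝ) : Prop :=
  (γ, μ) ∈ searchSet F p y ∧
    IsMinOn (fun q : ℝ≥0∞ × ℝ => URE F p τ y q.1 q.2) (searchSet F p y) (γ, μ)

theorem continuous_dataWeight {τ : ℝ} (hτ : 0 < τ) : Continuous (dataWeight τ) := by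
  have h : dataWeight τ = fun γ : ℝ≥0∞ => (ENNReal.ofReal τ / (ENNReal.ofReal τ + γ)).toReal := by
    funext γ
    unfold dataWeight
    split_ifs with hγ
    · simp [hγ]
    · rw [ENNReal.toReal_div, ENNReal.toReal_add (by simp) hγ, ENNReal.toReal_ofReal hτ.le]
  have hτ' : ENNReal.ofReal τ ≠ 0 := by simpa using hτ
  rw [h, continuous_iff_continuousAt]
  intro γ
  refine (ENNReal.tendsto_toReal ?_).comp ?_
  · exact (ENNReal.div_lt_top (by simp) (by simp [hτ])).ne
  · exact ENNReal.Tendsto.const_div (tendsto_const_nhds.add tendsto_id) (Or.inr (by simp))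

theorem shrinkWeight_eq {τ : ℝ} (hτ : 0 < τ) (γ : ℝ≥0∞) : shrinkWeight τ γ = 1 - dataWeight τ γ := by
  unfold dataWeight shrinkWeight
  have : 0 < τ + γ.toReal := by positivity
  split_ifs
  · simp
  · field_simp; ring

/-- The unbiased risk estimate has a minimizer on the search set, for every data vector. -/
theorem exists_isUREMinimizer (F : Family) (p : ℕ) {τ : ℕ → ℝ} (hτ : ∀ i, 0 < τ i) (y : ℕ → ℝ) :
    ∃ γ μ, IsUREMinimizer F p τ y γ μ := by
  have hc : Continuous fun q : ℝ≥0∞ × ℝ => URE F p τ y q.1 q.2 := by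
    unfold URE
    have h1 : ∀ i, Continuous fun q : ℝ≥0∞ × ℝ => dataWeight (τ i) q.1 :=
      fun i => (continuous_dataWeight (hτ i)).comp continuous_fst
    simp only [fun i γ => shrinkWeight_eq (hτ i) γ]
    refine continuous_const.mul (continuous_finsetSum _ fun i _ => ?_)
    have := h1 i
    fun_prop
  have hcl : IsClosed F.meanSpace := by
    cases F <;> simp only [Family.meanSpace] <;>
      first | exact isClosed_Icc | exact isClosed_Ici | exact isClosed_univ
  have h0 : (0 : ℝ) ∈ F.meanSpace := by cases F <;> simp [Family.meanSpace]
  have hS : searchSet F p y = Set.univ ×ˢ (Set.Icc (-maxAbs p y) (maxAbs p y) ∩ F.meanSpace) := by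
    ext q; simp [searchSet, abs_le]
  have hk : IsCompact (searchSet F p y) := by
    rw [hS]; exact isCompact_univ.prod (isCompact_Icc.inter_right hcl)
  have hne : (searchSet F p y).Nonempty :=
    ⟨(0, 0), by simpa [searchSet] using
      ⟨Real.iSup_nonneg fun i : Fin p => abs_nonneg (y i), h0⟩⟩
  obtain ⟨q, hq, hmin⟩ := hk.exists_isMinOn hne hc.continuousOn
  exact ⟨q.1, q.2, hq, hmin⟩

/-- The loss of the estimator with random parameters `(γ, μ)`, as a random variable. -/
def randomLoss {Ω : Type*} (p : ℕ) (θ τ : ℕ → ℝ) (Y : ℕ → Ω → ℝ) (γ : Ω → ℝ≥0∞) (μ : Ω → ℝ)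
    (ω : Ω) : ℝ :=
  loss p θ τ (fun i => Y i ω) (γ ω) (μ ω)

/-- The risk `E[loss]`. -/
def risk {Ω : Type*} [MeasurableSpace Ω] (P : Measure Ω) (p : ℕ) (θ τ : ℕ → ℝ) (Y : ℕ → Ω → ℝ)
    (γ : Ω → ℝ≥0∞) (μ : Ω → ℝ) : ℝ :=
  ∫ ω, randomLoss p θ τ Y γ μ ω ∂P

end NEFQVF

end

/-! The estimator minimizes `URE`, so it suffices that `URE` and the loss differ by a quantity that
is uniformly small over all admissible `(γ, μ)`. If this difference is at most `U p` with `E[U p] →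
0`, then the loss of the minimizer exceeds that of any competitor by at most `2 * U p`. Markov's
inequality then gives the statement in probability, and integration gives the statement on risks.

Because the variance function is quadratic, `E V(Y) = (1 + ν₂/τ) V(θ)`, so `V(Y)/(τ + ν₂)` is
unbiased for `Var Y`. In `URE - loss` the terms quadratic in the shrinkage weight cancel
(`URE_sub_loss`). What remains are three sums of independent centred variables: one without weights,
one weighted by `γ/(τᵢ + γ)`, and one with the same weights and the factor `μ`.

Uniformity in `γ` comes from monotonicity: for every `γ` the weights lie in `[0, 1]` and decrease in
`τ`. After sorting by `τ`, Abel summation bounds all weighted sums at once by the maximal partial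
sum, and Doob's `L²` inequality controls that maximum (`exists_weighted_sum_bound`). Uniformity in
`μ` costs the factor `max |Yᵢ|`, whose fourth power is at most `∑ Yᵢ⁴`.

The only inputs from the distributions are the first two moments, a bound `E Y⁴ ≤ K (1 + θ⁴)`
uniform in `i`, a quadratic bound on the variance estimate, support in `Θ`, and `∑ |θᵢ|³ = O(p)`;
the moment properties are collected in `MomentBound`. The discrete families satisfy a Panjer
recursion, which yields moments through a Stein identity. Gamma moments come from shifting the
shape, and GHS moments from differentiating `(cos t)^(-r)`. -/

noncomputable section

namespace NEFQVF

/-! ### A maximal inequality for weighted sums with monotone weights -/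

/-- The maximum of the partial sums `∑ i < j, x i` over `j ≤ n`. -/
def runMax (x : ℕ → ℝ) : ℕ → ℝ
  | 0 => 0
  | n + 1 => max (runMax x n) (∑ i ∈ Finset.range (n + 1), x i)

theorem runMax_nonneg (x : ℕ → ℝ) (n : ℕ) : 0 ≤ runMax x n := by
  induction n with
  | zero => exact le_rfl
  | succ n ih => exact ih.trans (le_max_left _ _)

theorem sum_le_runMax (x : ℕ → ℝ) (n : ℕ) : ∑ i ∈ Finset.range n, x i ≤ runMax x n := by
  cases n with
  | zero => simp [runMax]
  | succ n => exact le_max_right _ _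

theorem runMax_congr {x y : ℕ → ℝ} {n : ℕ} (h : ∀ i < n, x i = y i) : runMax x n = runMax y n := by
  induction n with
  | zero => rfl
  | succ n ih =>
    simp only [runMax]
    rw [ih fun i hi => h i (by omega),
      Finset.sum_congr rfl fun i hi => h i (Finset.mem_range.1 hi)]

theorem measurable_runMax {α : Type*} [MeasurableSpace α] {ξ : ℕ → α → ℝ}
    (hξ : ∀ i, Measurable (ξ i)) (n : ℕ) : Measurable fun a => runMax (fun i => ξ i a) n := by
  induction n with
  | zero => exact measurable_const
  | succ n ih =>
    simp only [runMax]
    exact ih.max (Finset.measurable_sum _ fun i _ => hξ i)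

/-- Abel summation: antitone weights in `[0, 1]` do not increase the maximum. -/
theorem sum_mul_le_runMax {w x : ℕ → ℝ} {n : ℕ} (hw : ∀ j k, j ≤ k → k < n → w k ≤ w j)
    (h0 : ∀ k < n, 0 ≤ w k) (h1 : ∀ k < n, w k ≤ 1) :
    ∑ k ∈ Finset.range n, w k * x k ≤ runMax x n := by
  cases n with
  | zero => simp [runMax]
  | succ n =>
    have key : ∀ m ≤ n, ∑ k ∈ Finset.range m, w k * x k
        ≤ (w 0 - w m) * runMax x m + w m * ∑ k ∈ Finset.range m, x k := by
      intro m hm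
      induction m with
      | zero => simp
      | succ m ih =>
        rw [Finset.sum_range_succ]
        have h2 : runMax x m ≤ runMax x (m + 1) := le_max_left _ _
        have h3 := sum_le_runMax x (m + 1)
        have h4 : w (m + 1) ≤ w m := hw m (m + 1) (by omega) (by omega)
        have h5 : w m ≤ w 0 := hw 0 m (by omega) (by omega)
        have h6 := ih (by omega)
        have h7 := mul_le_mul_of_nonneg_left h2 (sub_nonneg.2 h5)
        have h8 := mul_le_mul_of_nonneg_left h3 (sub_nonneg.2 h4)
        have h9 : ∑ k ∈ Finset.range (m + 1), x k = ∑ k ∈ Finset.range m, x k + x m :=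
          Finset.sum_range_succ _ _
        rw [h9] at h8 ⊢
        nlinarith
    rw [Finset.sum_range_succ]
    have h2 := key n le_rfl
    have h3 : runMax x n ≤ runMax x (n + 1) := le_max_left _ _
    have h4 := sum_le_runMax x (n + 1)
    have h5 : w n ≤ w 0 := hw 0 n (by omega) (by omega)
    have h6 := mul_le_mul_of_nonneg_left h3 (sub_nonneg.2 h5)
    have h7 := mul_le_mul_of_nonneg_left h4 (h0 n (by omega))
    have h8 := mul_le_mul_of_nonneg_right (h1 0 (by omega)) (runMax_nonneg x (n + 1))
    rw [Finset.sum_range_succ] at h7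
    nlinarith

/-- The pathwise form of Doob's `L²` maximal inequality. -/
theorem runMax_sq_add_le (x : ℕ → ℝ) (n : ℕ) :
    runMax x n ^ 2 + 4 * ∑ k ∈ Finset.range n, runMax x k * x k
      ≤ 4 * (∑ k ∈ Finset.range n, x k) ^ 2 := by
  -- With `M` the running maximum and `S` the partial sum, the inductive step from `M` to a new
  -- maximum `S'` loses exactly `(M - S')² / 2`; when the maximum does not change, nothing is lost.
  have key : ∑ k ∈ Finset.range n, runMax x k * x k
      ≤ runMax x n * ∑ k ∈ Finset.range n, x k - runMax x n ^ 2 / 2 := by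
    induction n with
    | zero => simp [runMax]
    | succ n ih =>
      have h9 : ∑ k ∈ Finset.range (n + 1), x k = ∑ k ∈ Finset.range n, x k + x n :=
        Finset.sum_range_succ _ _
      rw [Finset.sum_range_succ]
      simp only [runMax]
      rw [h9]
      rcases le_total (runMax x n) (∑ k ∈ Finset.range n, x k + x n) with h | h
      · rw [max_eq_right h]
        nlinarith [sq_nonneg (runMax x n - (∑ k ∈ Finset.range n, x k + x n))]
      · rw [max_eq_left h]; nlinarith
  nlinarith [sq_nonneg (runMax x n - 2 * ∑ k ∈ Finset.range n, x k)]

variable {Ω : Type*} [MeasurableSpace Ω] {P : Measure Ω}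

theorem memLp_runMax [IsProbabilityMeasure P] {ξ : ℕ → Ω → ℝ} (hL : ∀ i, MemLp (ξ i) 2 P) (n : ℕ) :
    MemLp (fun ω => runMax (fun i => ξ i ω) n) 2 P := by
  induction n with
  | zero => exact memLp_const 0
  | succ n ih => exact ih.sup (memLp_finsetSum _ fun i _ => hL i)

/-- The maximum at time `n` involves only the variables with index below `n`. The helper `e` extends
a tuple indexed by `range n` by zero, so that the maximum becomes a measurable function of that
tuple. -/
theorem indepFun_runMax {ξ : ℕ → Ω → ℝ} (hm : ∀ i, Measurable (ξ i)) (hind : iIndepFun ξ P)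
    (n : ℕ) : IndepFun (fun ω => runMax (fun i => ξ i ω) n) (ξ n) P := by
  have h := hind.indepFun_finset (Finset.range n) {n} (by simp) hm
  let e : ℕ → (Finset.range n → ℝ) → ℝ := fun i v =>
    if hi : i ∈ Finset.range n then v ⟨i, hi⟩ else 0
  have he : ∀ i, Measurable (e i) := by
    intro i
    by_cases hi : i ∈ Finset.range n
    · simp only [e, hi, dif_pos]; fun_prop
    · simp only [e, hi, dif_neg, not_false_iff]; fun_prop
  have hψ : Measurable fun v : ({n} : Finset ℕ) → ℝ => v ⟨n, by simp⟩ := measurable_pi_apply _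
  have h2 := h.comp (measurable_runMax he n) hψ
  refine h2.congr (ae_of_all _ fun ω => ?_) (ae_of_all _ fun ω => rfl)
  exact runMax_congr fun i hi => by simp [e, hi]

/-- Taking expectations in `runMax_sq_add_le` suffices: each cross term vanishes by independence and
centring, and the second moment of the final sum is the sum of the variances. -/
theorem integral_runMax_sq_le [IsProbabilityMeasure P] {ξ : ℕ → Ω → ℝ}
    (hm : ∀ i, Measurable (ξ i)) (hind : iIndepFun ξ P) (hL : ∀ i, MemLp (ξ i) 2 P)
    (h0 : ∀ i, ∫ ω, ξ i ω ∂P = 0) (n : ℕ) :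
    ∫ ω, runMax (fun i => ξ i ω) n ^ 2 ∂P
      ≤ 4 * ∑ i ∈ Finset.range n, ∫ ω, ξ i ω ^ 2 ∂P := by
  have hS : MemLp (fun ω => ∑ i ∈ Finset.range n, ξ i ω) 2 P := memLp_finsetSum _ fun i _ => hL i
  have hcross : ∀ k, Integrable (fun ω => runMax (fun i => ξ i ω) k * ξ k ω) P := fun k =>
    (memLp_runMax hL k).integrable_mul (hL k)
  have hzero : ∀ k, ∫ ω, runMax (fun i => ξ i ω) k * ξ k ω ∂P = 0 := fun k => by
    have := (indepFun_runMax hm hind k).integral_fun_mul_eq_mul_integral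
      (memLp_runMax hL k).aestronglyMeasurable (hL k).aestronglyMeasurable
    rw [this, h0, mul_zero]
  have hvar : ∫ ω, (∑ i ∈ Finset.range n, ξ i ω) ^ 2 ∂P
      = ∑ i ∈ Finset.range n, ∫ ω, ξ i ω ^ 2 ∂P := by
    have h1 := IndepFun.variance_sum (s := Finset.range n) (X := ξ) (μ := P) (fun i _ => hL i)
      (fun i _ j _ hij => hind.indepFun hij)
    have h2 : ∀ i, Var[ξ i; P] = ∫ ω, ξ i ω ^ 2 ∂P := fun i =>
      variance_of_integral_eq_zero (hm i).aemeasurable (h0 i)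
    have h3 : ∑ i ∈ Finset.range n, ξ i = fun ω => ∑ i ∈ Finset.range n, ξ i ω := by
      ext ω; simp
    rw [h3, variance_of_integral_eq_zero
      (Finset.measurable_sum _ fun i _ => hm i).aemeasurable] at h1
    · simpa [h2] using h1
    · rw [integral_finsetSum _ fun i _ => (hL i).integrable (by norm_num)]
      simp [h0]
  have hle : ∫ ω, (runMax (fun i => ξ i ω) n ^ 2
      + 4 * ∑ k ∈ Finset.range n, runMax (fun i => ξ i ω) k * ξ k ω) ∂P
      ≤ ∫ ω, 4 * (∑ i ∈ Finset.range n, ξ i ω) ^ 2 ∂P := by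
    refine integral_mono ?_ (hS.integrable_sq.const_mul 4) fun ω => runMax_sq_add_le _ n
    exact (memLp_runMax hL n).integrable_sq.add
      ((integrable_finsetSum _ fun k _ => hcross k).const_mul 4)
  rw [integral_add (memLp_runMax hL n).integrable_sq
    ((integrable_finsetSum _ fun k _ => hcross k).const_mul 4), integral_const_mul,
    integral_finsetSum _ fun k _ => hcross k, integral_const_mul, hvar] at hle
  simpa [hzero] using hle

/-- The order is deterministic, so reindexing by `σ` preserves independence and makes every weight
that decreases in `τ` antitone in the index. Extending `σ` by the identity beyond `p` keeps it a
permutation of `ℕ`. -/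
theorem exists_perm_sorted (τ : ℕ → ℝ) (p : ℕ) : ∃ σ : Equiv.Perm ℕ,
    (∀ k, σ k < p ↔ k < p) ∧ ∀ j k, j ≤ k → k < p → τ (σ j) ≤ τ (σ k) := by
  let f : Fin p → ℝ := fun i => τ i
  let σ : Equiv.Perm ℕ := (Tuple.sort f).extendDomain Fin.equivSubtype
  have hσ : ∀ i : Fin p, σ i = Tuple.sort f i := fun i =>
    Equiv.Perm.extendDomain_apply_image (Tuple.sort f) Fin.equivSubtype i
  have hσ' : ∀ k, ¬ k < p → σ k = k := fun k hk =>
    Equiv.Perm.extendDomain_apply_not_subtype (Tuple.sort f) Fin.equivSubtype hk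
  refine ⟨σ, fun k => ?_, fun j k hjk hk => ?_⟩
  · by_cases hk : k < p
    · have := hσ ⟨k, hk⟩
      simp only at this
      simp [this, hk]
    · rw [hσ' k hk]
  · have h1 := hσ ⟨k, hk⟩
    have h2 := hσ ⟨j, by omega⟩
    simp only at h1 h2
    rw [h1, h2]
    exact Tuple.monotone_sort f (show (⟨j, by omega⟩ : Fin p) ≤ ⟨k, hk⟩ from hjk)

/-- A square integrable bound, uniform over all weights in `[0, 1]` that decrease in `τ`, for the
weighted sums of centred independent random variables. -/
theorem exists_weighted_sum_bound [IsProbabilityMeasure P] {ξ : ℕ → Ω → ℝ}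
    (hm : ∀ i, Measurable (ξ i)) (hind : iIndepFun ξ P) (hL : ∀ i, MemLp (ξ i) 2 P)
    (h0 : ∀ i, ∫ ω, ξ i ω ∂P = 0) (τ : ℕ → ℝ) (p : ℕ) :
    ∃ M : Ω → ℝ, MemLp M 2 P ∧ (∀ ω, 0 ≤ M ω) ∧
      ∫ ω, M ω ^ 2 ∂P ≤ 16 * ∑ i ∈ Finset.range p, ∫ ω, ξ i ω ^ 2 ∂P ∧
      ∀ (ω : Ω) (w : ℕ → ℝ), (∀ i j, τ i ≤ τ j → w j ≤ w i) → (∀ i, 0 ≤ w i) → (∀ i, w i ≤ 1) →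
        |∑ i ∈ Finset.range p, w i * ξ i ω| ≤ M ω := by
  obtain ⟨σ, hσp, hσ⟩ := exists_perm_sorted τ p
  have hre : ∀ f : ℕ → ℝ, ∑ k ∈ Finset.range p, f (σ k) = ∑ k ∈ Finset.range p, f k := fun f =>
    Finset.sum_equiv σ (fun i => by simp [hσp]) fun i _ => rfl
  -- `A` controls the weighted sums from above and `B` from below. The constant 16 is `2 * 4 + 2 *
  -- 4`, from `(A + B)² ≤ 2A² + 2B²` and Doob's constant 4.
  let A : Ω → ℝ := fun ω => runMax (fun k => ξ (σ k) ω) p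
  let B : Ω → ℝ := fun ω => runMax (fun k => -ξ (σ k) ω) p
  have hindA : iIndepFun (fun k => ξ (σ k)) P := hind.precomp σ.injective
  have hindB : iIndepFun (fun k ω => -ξ (σ k) ω) P :=
    hindA.comp (fun _ x => -x) fun _ => measurable_neg
  have hA : MemLp A 2 P := memLp_runMax (fun k => hL (σ k)) p
  have hB : MemLp B 2 P := memLp_runMax (fun k => (hL (σ k)).neg) p
  have hA2 := integral_runMax_sq_le (fun k => hm (σ k)) hindA (fun k => hL (σ k))
    (fun k => h0 (σ k)) p
  have hB2 := integral_runMax_sq_le (fun k => (hm (σ k)).neg) hindB (fun k => (hL (σ k)).neg)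
    (fun k => by simp [integral_neg, h0 (σ k)]) p
  simp only [Pi.neg_apply, neg_sq] at hB2
  rw [hre fun i => ∫ ω, ξ i ω ^ 2 ∂P] at hA2 hB2
  refine ⟨fun ω => A ω + B ω, hA.add hB,
    fun ω => add_nonneg (runMax_nonneg _ _) (runMax_nonneg _ _), ?_, fun ω w hw hw0 hw1 => ?_⟩
  · have : ∫ ω, (A ω + B ω) ^ 2 ∂P ≤ ∫ ω, (2 * A ω ^ 2 + 2 * B ω ^ 2) ∂P := by
      refine integral_mono (hA.add hB).integrable_sq
        ((hA.integrable_sq.const_mul 2).add (hB.integrable_sq.const_mul 2)) fun ω => ?_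
      dsimp only
      nlinarith [sq_nonneg (A ω - B ω)]
    rw [integral_add (hA.integrable_sq.const_mul 2) (hB.integrable_sq.const_mul 2),
      integral_const_mul, integral_const_mul] at this
    linarith
  · have h1 : ∑ k ∈ Finset.range p, w (σ k) * ξ (σ k) ω ≤ A ω :=
      sum_mul_le_runMax (fun j k hjk hk => hw _ _ (hσ j k hjk hk)) (fun _ _ => hw0 _)
        fun _ _ => hw1 _
    have h2 : ∑ k ∈ Finset.range p, w (σ k) * -ξ (σ k) ω ≤ B ω :=
      sum_mul_le_runMax (fun j k hjk hk => hw _ _ (hσ j k hjk hk)) (fun _ _ => hw0 _)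
        fun _ _ => hw1 _
    rw [hre fun i => w i * ξ i ω] at h1
    rw [hre fun i => w i * -ξ i ω] at h2
    simp only [mul_neg, Finset.sum_neg_distrib] at h2
    have h3 : 0 ≤ A ω := runMax_nonneg _ _
    have h4 : 0 ≤ B ω := runMax_nonneg _ _
    rw [abs_le]; constructor <;> linarith

/-! ### Deterministic facts on weights, losses and power sums -/

theorem shrinkWeight_nonneg {τ : ℝ} (hτ : 0 < τ) (γ : ℝ≥0∞) : 0 ≤ shrinkWeight τ γ := by
  unfold shrinkWeight; split_ifs <;> positivity

theorem dataWeight_nonneg {τ : ℝ} (hτ : 0 < τ) (γ : ℝ≥0∞) : 0 ≤ dataWeight τ γ := by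
  unfold dataWeight; split_ifs <;> positivity

theorem shrinkWeight_le_one {τ : ℝ} (hτ : 0 < τ) (γ : ℝ≥0∞) : shrinkWeight τ γ ≤ 1 := by
  have := dataWeight_nonneg hτ γ
  rw [shrinkWeight_eq hτ]; linarith

theorem shrinkWeight_anti {τ τ' : ℝ} (hτ : 0 < τ) (h : τ ≤ τ') (γ : ℝ≥0∞) :
    shrinkWeight τ' γ ≤ shrinkWeight τ γ := by
  unfold shrinkWeight; split_ifs
  · exact le_rfl
  · gcongr

theorem maxAbs_nonneg (p : ℕ) (y : ℕ → ℝ) : 0 ≤ maxAbs p y :=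
  Real.iSup_nonneg fun i : Fin p => abs_nonneg (y i)

theorem exists_maxAbs_eq {p : ℕ} (hp : 0 < p) (y : ℕ → ℝ) : ∃ i < p, maxAbs p y = |y i| := by
  have : Nonempty (Fin p) := ⟨⟨0, hp⟩⟩
  obtain ⟨i, hi⟩ := exists_eq_ciSup_of_finite (f := fun i : Fin p => |y i|)
  exact ⟨i, i.2, hi.symm⟩

theorem maxAbs_le_sum (p : ℕ) (y : ℕ → ℝ) : maxAbs p y ≤ ∑ i ∈ Finset.range p, |y i| := by
  rcases Nat.eq_zero_or_pos p with rfl | hp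
  · simp [maxAbs]
  · obtain ⟨i, hi, h⟩ := exists_maxAbs_eq hp y
    rw [h]
    exact Finset.single_le_sum (f := fun i => |y i|) (fun _ _ => abs_nonneg _) (by simpa using hi)

theorem maxAbs_pow_four_le {p : ℕ} (hp : 0 < p) (y : ℕ → ℝ) :
    maxAbs p y ^ 4 ≤ ∑ i ∈ Finset.range p, y i ^ 4 := by
  obtain ⟨i, hi, h⟩ := exists_maxAbs_eq hp y
  rw [h, Even.pow_abs (by decide)]
  exact Finset.single_le_sum (f := fun i => y i ^ 4) (fun _ _ => by positivity) (by simpa using hi)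

/-- With weight `s`, the loss term is `((y - θ) - s (y - μ))²`; its `s²` part is also present in
`URE`. Hence `s` enters the difference linearly and `μ` factors out of its sum. The factor `1 *`
presents the first sum as a weighted one. -/
theorem URE_sub_loss (F : Family) (p : ℕ) {θ τ : ℕ → ℝ} (hτ : ∀ i, 0 < τ i) (y : ℕ → ℝ)
    (γ : ℝ≥0∞) (μ : ℝ) :
    URE F p τ y γ μ - loss p θ τ y γ μ = 1 / (p : ℝ) *
      (∑ i ∈ Finset.range p, 1 * (F.V (y i) / (τ i + F.nu2) - (y i - θ i) ^ 2)
        + 2 * ∑ i ∈ Finset.range p,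
          shrinkWeight (τ i) γ * (y i ^ 2 - θ i * y i - F.V (y i) / (τ i + F.nu2))
        - 2 * μ * ∑ i ∈ Finset.range p, shrinkWeight (τ i) γ * (y i - θ i)) := by
  unfold URE loss estimate
  rw [← mul_sub, ← Finset.sum_sub_distrib, Finset.mul_sum _ _ 2, Finset.mul_sum _ _ (2 * μ),
    ← Finset.sum_add_distrib, ← Finset.sum_sub_distrib]
  congr 1
  refine Finset.sum_congr rfl fun i _ => ?_
  have h : dataWeight (τ i) γ = 1 - shrinkWeight (τ i) γ := by rw [shrinkWeight_eq (hτ i)]; ring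
  rw [h]; ring

/-- The cubic bound forces `max |θᵢ| = O(p^(1/3)) = o(p)`, so `∑ θᵢ⁴ ≤ max |θᵢ| * ∑ |θᵢ|³ = o(p²)`.
-/
theorem eventually_sum_pow_four_le {θ : ℕ → ℝ}
    (hsum : (fun p : ℕ => ∑ i ∈ Finset.range p, |θ i| ^ 3) =O[atTop] fun p : ℕ => (p : ℝ))
    {ε : ℝ} (hε : 0 < ε) :
    ∀ᶠ p : ℕ in atTop, ∑ i ∈ Finset.range p, (1 + θ i ^ 4) ≤ ε * (p : ℝ) ^ 2 := by
  obtain ⟨C, hC, hb⟩ := hsum.exists_pos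
  have hb := hb.bound
  -- Chosen so that `e * C = ε / 2`; the other half of `ε` absorbs the constant terms `1`.
  set e := ε / (2 * C) with he
  have hepos : 0 < e := by positivity
  filter_upwards [hb, eventually_ge_atTop 1,
    (tendsto_natCast_atTop_atTop (R := ℝ)).eventually_ge_atTop (2 / ε),
    (tendsto_natCast_atTop_atTop (R := ℝ)).eventually_ge_atTop (C / e ^ 3)] with p hp hp1 hp2 hp3
  have hp1' : (1 : ℝ) ≤ p := by exact_mod_cast hp1
  have hnn : 0 ≤ ∑ i ∈ Finset.range p, |θ i| ^ 3 := Finset.sum_nonneg fun _ _ => by positivity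
  rw [Real.norm_of_nonneg hnn, Real.norm_of_nonneg (by positivity)] at hp
  have hmax : ∀ i ∈ Finset.range p, |θ i| ≤ e * p := by
    intro i hi
    have h1 : |θ i| ^ 3 ≤ C * p :=
      (Finset.single_le_sum (f := fun i => |θ i| ^ 3) (fun _ _ => by positivity) hi).trans hp
    refine (pow_le_pow_iff_left₀ (abs_nonneg _) (by positivity) (n := 3) (by norm_num)).1 ?_
    rw [div_le_iff₀ (by positivity)] at hp3
    calc |θ i| ^ 3 ≤ C * p := h1
      _ ≤ (p * e ^ 3) * p := by gcongr
      _ ≤ (p * e ^ 3) * p * p := le_mul_of_one_le_right (by positivity) hp1'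
      _ = (e * p) ^ 3 := by ring
  have h4 : ∑ i ∈ Finset.range p, θ i ^ 4 ≤ e * p * (C * p) := by
    calc ∑ i ∈ Finset.range p, θ i ^ 4 ≤ ∑ i ∈ Finset.range p, e * p * |θ i| ^ 3 := by
          refine Finset.sum_le_sum fun i hi => ?_
          rw [← Even.pow_abs (by decide : Even 4), pow_succ' |θ i| 3]
          exact mul_le_mul_of_nonneg_right (hmax i hi) (by positivity)
      _ = e * p * ∑ i ∈ Finset.range p, |θ i| ^ 3 := by rw [Finset.mul_sum]
      _ ≤ e * p * (C * p) := by gcongr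
  have h5 : e * p * (C * p) = ε / 2 * (p : ℝ) ^ 2 := by rw [he]; field_simp
  have h6 : (p : ℝ) ≤ ε / 2 * (p : ℝ) ^ 2 := by
    rw [div_le_iff₀ hε] at hp2
    nlinarith
  rw [Finset.sum_add_distrib, Finset.sum_const, Finset.card_range, nsmul_eq_mul, mul_one]
  linarith

theorem exists_sum_sq_le {θ : ℕ → ℝ}
    (hsum : (fun p : ℕ => ∑ i ∈ Finset.range p, |θ i| ^ 3) =O[atTop] fun p : ℕ => (p : ℝ)) :
    ∃ C : ℝ, 0 ≤ C ∧ ∀ᶠ p : ℕ in atTop, ∑ i ∈ Finset.range p, (1 + θ i ^ 2) ≤ C * p := by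
  obtain ⟨C, hC, hb⟩ := hsum.exists_pos
  refine ⟨2 + C, by positivity, ?_⟩
  filter_upwards [hb.bound] with p hp
  have hnn : 0 ≤ ∑ i ∈ Finset.range p, |θ i| ^ 3 := Finset.sum_nonneg fun _ _ => by positivity
  rw [Real.norm_of_nonneg hnn, Real.norm_of_nonneg (by positivity)] at hp
  calc ∑ i ∈ Finset.range p, (1 + θ i ^ 2) ≤ ∑ i ∈ Finset.range p, (2 + |θ i| ^ 3) := by
        refine Finset.sum_le_sum fun i _ => ?_
        rw [← sq_abs]
        nlinarith [abs_nonneg (θ i), sq_nonneg (|θ i| - 1),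
          mul_nonneg (abs_nonneg (θ i)) (sq_nonneg (|θ i| - 1))]
    _ = 2 * p + ∑ i ∈ Finset.range p, |θ i| ^ 3 := by
        rw [Finset.sum_add_distrib, Finset.sum_const, Finset.card_range, nsmul_eq_mul]; ring
    _ ≤ (2 + C) * p := by linarith

/-! ### The uniform bound of the difference between the risk estimate and the loss -/

theorem measurable_maxAbs {Y : ℕ → Ω → ℝ} (hm : ∀ i, Measurable (Y i)) (p : ℕ) :
    Measurable fun ω => maxAbs p fun i => Y i ω := by
  unfold maxAbs
  exact Measurable.iSup fun i => (hm i).abs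

theorem memLp_two_of_integrable_pow_four [IsProbabilityMeasure P] {X : Ω → ℝ} (hm : Measurable X)
    (h4 : Integrable (fun ω => X ω ^ 4) P) : MemLp X 2 P := by
  rw [memLp_two_iff_integrable_sq hm.aestronglyMeasurable]
  refine ((integrable_const (1 : ℝ)).add h4).mono' (by fun_prop) (ae_of_all _ fun ω => ?_)
  rw [Real.norm_of_nonneg (by positivity)]
  simp only [Pi.add_apply]
  nlinarith [sq_nonneg (X ω ^ 2 - 1)]

theorem memLp_maxAbs {Y : ℕ → Ω → ℝ} (hm : ∀ i, Measurable (Y i)) (hL : ∀ i, MemLp (Y i) 2 P)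
    (p : ℕ) : MemLp (fun ω => maxAbs p fun i => Y i ω) 2 P := by
  refine MemLp.mono' (g := fun ω => ∑ i ∈ Finset.range p, |Y i ω|)
    (memLp_finsetSum _ fun i _ => (hL i).abs) (measurable_maxAbs hm p).aestronglyMeasurable
    (ae_of_all _ fun ω => ?_)
  rw [Real.norm_of_nonneg (maxAbs_nonneg _ _)]
  exact maxAbs_le_sum _ _

theorem memLp_two_of_sq_le {X g : Ω → ℝ} (hm : Measurable X) (hg : Integrable g P)
    (h : ∀ ω, X ω ^ 2 ≤ g ω) : MemLp X 2 P := by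
  rw [memLp_two_iff_integrable_sq hm.aestronglyMeasurable]
  refine hg.mono' (by fun_prop) (ae_of_all _ fun ω => ?_)
  rw [Real.norm_of_nonneg (by positivity)]
  exact h ω

theorem integral_sq_le_of_sq_le {X : Ω → ℝ} {Z : Ω → ℝ} {C K t : ℝ} [IsProbabilityMeasure P]
    (hX : MemLp X 2 P) (hC : 0 ≤ C) (h4 : Integrable (fun ω => Z ω ^ 4) P)
    (hK : ∫ ω, Z ω ^ 4 ∂P ≤ K * (1 + t ^ 4))
    (h : ∀ ω, X ω ^ 2 ≤ C * (1 + t ^ 4 + Z ω ^ 4)) :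
    ∫ ω, X ω ^ 2 ∂P ≤ C * (1 + K) * (1 + t ^ 4) := by
  have h1 : Integrable (fun ω => 1 + t ^ 4 + Z ω ^ 4) P := (integrable_const _).add h4
  refine (integral_mono hX.integrable_sq (h1.const_mul C) h).trans ?_
  rw [integral_const_mul, integral_add (integrable_const _) h4]
  simp only [integral_const, probReal_univ, one_smul]
  nlinarith [mul_le_mul_of_nonneg_left hK hC]

/-- Completing squares replaces every product by terms whose expectations are known: `A²`, `B²` and
`S` will be small multiples of `p²`, and `Z²` will be `O(p)`. The powers of `δ` are balanced so that
every term ends up of order `δ`. -/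
theorem bound_le_of_pos {p δ A B X Z S : ℝ} (hp : 0 < p) (hδ : 0 < δ) (hS : X ^ 4 ≤ S) :
    1 / p * (A + 2 * B + 2 * (X * Z)) ≤
      2 * δ + (1 / (2 * δ * p ^ 2)) * A ^ 2 + (1 / (δ * p ^ 2)) * B ^ 2
        + (1 / (2 * δ ^ 3 * p ^ 2)) * S + δ / p * Z ^ 2 := by
  have h1 : 1 / p * A ≤ δ / 2 + (1 / (2 * δ * p ^ 2)) * A ^ 2 := by
    have : δ / 2 + (1 / (2 * δ * p ^ 2)) * A ^ 2 - 1 / p * A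
        = (δ - A / p) ^ 2 / (2 * δ) := by field_simp; ring
    have : 0 ≤ (δ - A / p) ^ 2 / (2 * δ) := by positivity
    linarith
  have h2 : 1 / p * (2 * B) ≤ δ + (1 / (δ * p ^ 2)) * B ^ 2 := by
    have : δ + (1 / (δ * p ^ 2)) * B ^ 2 - 1 / p * (2 * B)
        = (δ - B / p) ^ 2 / δ := by field_simp; ring
    have : 0 ≤ (δ - B / p) ^ 2 / δ := by positivity
    linarith
  have h3 : 1 / p * (2 * (X * Z)) ≤ X ^ 2 / (δ * p) + δ / p * Z ^ 2 := by
    have : X ^ 2 / (δ * p) + δ / p * Z ^ 2 - 1 / p * (2 * (X * Z))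
        = (X - δ * Z) ^ 2 / (δ * p) := by field_simp; ring
    have : 0 ≤ (X - δ * Z) ^ 2 / (δ * p) := by positivity
    linarith
  have h4 : X ^ 2 / (δ * p) ≤ δ / 2 + (1 / (2 * δ ^ 3 * p ^ 2)) * X ^ 4 := by
    have : δ / 2 + (1 / (2 * δ ^ 3 * p ^ 2)) * X ^ 4 - X ^ 2 / (δ * p)
        = (δ ^ 2 - X ^ 2 / p) ^ 2 / (2 * δ ^ 3) := by field_simp; ring
    have : 0 ≤ (δ ^ 2 - X ^ 2 / p) ^ 2 / (2 * δ ^ 3) := by positivity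
    linarith
  have h5 : (1 / (2 * δ ^ 3 * p ^ 2)) * X ^ 4 ≤ (1 / (2 * δ ^ 3 * p ^ 2)) * S := by gcongr
  rw [mul_add, mul_add]
  linarith

/-- An integrable bound of the difference between the risk estimate and the loss, uniform over the
shrinkage parameters, whose expectation tends to `0`. -/
theorem exists_uniform_bound [IsProbabilityMeasure P] {F : Family} {τ θ : ℕ → ℝ} {Y : ℕ → Ω → ℝ}
    (hm : ∀ i, Measurable (Y i)) (hind : iIndepFun Y P) (hτ : ∀ i, 0 < τ i)
    (hτ' : ∀ i, 0 < τ i + F.nu2) (h4 : ∀ i, Integrable (fun ω => Y i ω ^ 4) P)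
    (h1 : ∀ i, ∫ ω, Y i ω ∂P = θ i)
    (h2 : ∀ i, ∫ ω, Y i ω ^ 2 ∂P = θ i ^ 2 + F.V (θ i) / τ i) {K : ℝ}
    (hK : ∀ i, ∫ ω, Y i ω ^ 4 ∂P ≤ K * (1 + θ i ^ 4))
    (hV : ∀ i y, |F.V y / (τ i + F.nu2)| ≤ K * (1 + y ^ 2))
    (hsum : (fun p : ℕ => ∑ i ∈ Finset.range p, |θ i| ^ 3) =O[atTop] fun p : ℕ => (p : ℝ)) :
    ∃ U : ℕ → Ω → ℝ, (∀ p, Integrable (U p) P) ∧ (∀ p ω, 0 ≤ U p ω) ∧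
      Tendsto (fun p => ∫ ω, U p ω ∂P) atTop (𝓝 0) ∧
      ∀ p ω γ μ, |μ| ≤ maxAbs p (fun i => Y i ω) →
        |URE F p τ (fun i => Y i ω) γ μ - loss p θ τ (fun i => Y i ω) γ μ| ≤ U p ω := by
  have hK0 : 0 ≤ K := by
    have : 0 ≤ ∫ ω, Y 0 ω ^ 4 ∂P := integral_nonneg fun ω => by positivity
    have := this.trans (hK 0)
    by_contra hneg
    have : K * (1 + θ 0 ^ 4) < 0 := mul_neg_of_neg_of_pos (by linarith) (by positivity)
    linarith
  have hY2 : ∀ i, MemLp (Y i) 2 P := fun i => memLp_two_of_integrable_pow_four (hm i) (h4 i)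
  have hY1 : ∀ i, Integrable (Y i) P := fun i => (hY2 i).integrable (by norm_num)
  have hVm : Measurable F.V := by unfold Family.V; fun_prop
  let va : ℕ → ℝ → ℝ := fun i y => F.V y / (τ i + F.nu2)
  have hva : ∀ i, Measurable (va i) := fun i => hVm.div_const _
  have hvsq : ∀ i y, va i y ^ 2 ≤ 2 * K ^ 2 * (1 + y ^ 4) := by
    intro i y
    have h := hV i y
    have h' : va i y ^ 2 ≤ (K * (1 + y ^ 2)) ^ 2 := by
      rw [← sq_abs]; exact pow_le_pow_left₀ (abs_nonneg _) h 2
    nlinarith [mul_nonneg (sq_nonneg K) (sq_nonneg (y ^ 2 - 1))]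
  have hvint : ∀ i, Integrable (fun ω => va i (Y i ω)) P := fun i => by
    refine (((integrable_const (1 : ℝ)).add (hY2 i).integrable_sq).const_mul K).mono'
      ((hva i).comp (hm i)).aestronglyMeasurable (ae_of_all _ fun ω => ?_)
    exact hV i (Y i ω)
  -- Here the quadratic form of `V` is used: `E V(Y) = V(θ) + ν₂ V(θ)/τ = V(θ) (τ + ν₂)/τ`.
  have hvmean : ∀ i, ∫ ω, va i (Y i ω) ∂P = F.V (θ i) / τ i := by
    intro i
    have e1 : ∫ ω, F.V (Y i ω) ∂P
        = F.nu0 + F.nu1 * θ i + F.nu2 * (θ i ^ 2 + F.V (θ i) / τ i) := by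
      have i1 : Integrable (fun ω => F.nu0 + F.nu1 * Y i ω) P :=
        (integrable_const _).add ((hY1 i).const_mul _)
      have i2 : ∀ ω, F.V (Y i ω) = F.nu0 + F.nu1 * Y i ω + F.nu2 * Y i ω ^ 2 := fun ω => rfl
      simp only [i2]
      rw [integral_add i1 ((hY2 i).integrable_sq.const_mul _), integral_add (integrable_const _)
        ((hY1 i).const_mul _), integral_const_mul, integral_const_mul, h1, h2]
      simp
    have e2 : ∫ ω, va i (Y i ω) ∂P = (∫ ω, F.V (Y i ω) ∂P) / (τ i + F.nu2) := integral_div _ _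
    have := (hτ i).ne'
    have := (hτ' i).ne'
    rw [e2, e1, div_eq_iff (by assumption)]
    have e3 : F.V (θ i) = F.nu0 + F.nu1 * θ i + F.nu2 * θ i ^ 2 := rfl
    field_simp
    rw [e3]; ring
  -- The summands of the three sums in `URE_sub_loss`.
  let fa : ℕ → ℝ → ℝ := fun i y => va i y - (y - θ i) ^ 2
  let fb : ℕ → ℝ → ℝ := fun i y => y ^ 2 - θ i * y - va i y
  let fz : ℕ → ℝ → ℝ := fun i y => y - θ i
  have hfa : ∀ i, Measurable (fa i) := fun i => by have := hva i; fun_prop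
  have hfb : ∀ i, Measurable (fb i) := fun i => by have := hva i; fun_prop
  have hfz : ∀ i, Measurable (fz i) := fun i => by fun_prop
  set C : ℝ := 4 * K ^ 2 + 16 with hC
  have hC0 : 0 ≤ C := by positivity
  have ha2 : ∀ i y, fa i y ^ 2 ≤ C * (1 + θ i ^ 4 + y ^ 4) := by
    intro i y
    have e := hvsq i y
    have e0 : 0 ≤ K ^ 2 * θ i ^ 4 := by positivity
    have e1 : fa i y ^ 2 ≤ 2 * va i y ^ 2 + 2 * (y - θ i) ^ 4 := by
      simp only [fa]; nlinarith [sq_nonneg (va i y + (y - θ i) ^ 2)]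
    have e2 : (y - θ i) ^ 4 ≤ 8 * (y ^ 4 + θ i ^ 4) := by
      have : (y - θ i) ^ 2 ≤ 2 * (y ^ 2 + θ i ^ 2) := by nlinarith [sq_nonneg (y + θ i)]
      have := pow_le_pow_left₀ (sq_nonneg _) this 2
      nlinarith [sq_nonneg (y ^ 2 - θ i ^ 2)]
    nlinarith
  have hb2 : ∀ i y, fb i y ^ 2 ≤ C * (1 + θ i ^ 4 + y ^ 4) := by
    intro i y
    have e := hvsq i y
    have e0 : 0 ≤ K ^ 2 * θ i ^ 4 := by positivity
    have e1 : fb i y ^ 2 ≤ 2 * va i y ^ 2 + 2 * (y ^ 2 - θ i * y) ^ 2 := by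
      simp only [fb]; nlinarith [sq_nonneg (va i y + (y ^ 2 - θ i * y))]
    have e2 : (y ^ 2 - θ i * y) ^ 2 ≤ 3 * y ^ 4 + θ i ^ 4 := by
      nlinarith [sq_nonneg (y ^ 2 + θ i * y), sq_nonneg (y ^ 2 - θ i ^ 2)]
    have e3 : 0 ≤ y ^ 4 := by positivity
    have e4 : 0 ≤ θ i ^ 4 := by positivity
    nlinarith
  have hgint : ∀ i, Integrable (fun ω => C * (1 + θ i ^ 4 + Y i ω ^ 4)) P := fun i =>
    ((integrable_const _).add (h4 i)).const_mul C
  have haL : ∀ i, MemLp (fun ω => fa i (Y i ω)) 2 P := fun i =>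
    memLp_two_of_sq_le ((hfa i).comp (hm i)) (hgint i) fun ω => ha2 i _
  have hbL : ∀ i, MemLp (fun ω => fb i (Y i ω)) 2 P := fun i =>
    memLp_two_of_sq_le ((hfb i).comp (hm i)) (hgint i) fun ω => hb2 i _
  have hzL : ∀ i, MemLp (fun ω => fz i (Y i ω)) 2 P := fun i => (hY2 i).sub (memLp_const _)
  have hz0 : ∀ i, ∫ ω, fz i (Y i ω) ∂P = 0 := fun i => by
    simp only [fz]
    rw [integral_sub (hY1 i) (integrable_const _), h1]; simp
  have hsqint : ∀ i, ∫ ω, (Y i ω ^ 2 - θ i * Y i ω) ∂P = F.V (θ i) / τ i := fun i => by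
    rw [integral_sub (hY2 i).integrable_sq ((hY1 i).const_mul _), integral_const_mul, h1, h2]
    ring
  have hb0 : ∀ i, ∫ ω, fb i (Y i ω) ∂P = 0 := fun i => by
    have i1 : Integrable (fun ω => Y i ω ^ 2 - θ i * Y i ω) P :=
      (hY2 i).integrable_sq.sub ((hY1 i).const_mul _)
    simp only [fb]
    rw [integral_sub i1 (hvint i), hvmean, hsqint,
      sub_self]
  have ha0 : ∀ i, ∫ ω, fa i (Y i ω) ∂P = 0 := fun i => by
    have e : ∀ ω, fa i (Y i ω) = -fb i (Y i ω) + θ i * fz i (Y i ω) := fun ω => by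
      simp only [fa, fb, fz]; ring
    have i1 : Integrable (fun ω => -fb i (Y i ω)) P := ((hbL i).integrable (by norm_num)).neg
    simp only [e]
    rw [integral_add i1
      (((hzL i).integrable (by norm_num)).const_mul _), integral_neg, integral_const_mul, hb0, hz0]
    simp
  -- The bound must be of order `θ²`, not `θ⁴`, to make the sum `O(p)`. It follows from the fourth
  -- moment by `2y² ≤ y⁴/(1 + θ²) + (1 + θ²)`.
  have hz2 : ∀ i, ∫ ω, fz i (Y i ω) ^ 2 ∂P ≤ (K + 3) * (1 + θ i ^ 2) := by
    intro i
    have hT : 0 < 1 + θ i ^ 2 := by positivity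
    have e : ∀ ω, fz i (Y i ω) ^ 2
        ≤ (1 / (1 + θ i ^ 2)) * Y i ω ^ 4 + ((1 + θ i ^ 2) + 2 * θ i ^ 2) := by
      intro ω
      have e1 : fz i (Y i ω) ^ 2 ≤ 2 * Y i ω ^ 2 + 2 * θ i ^ 2 := by
        simp only [fz]; nlinarith [sq_nonneg (Y i ω + θ i)]
      have e2 : (1 / (1 + θ i ^ 2)) * Y i ω ^ 4 + (1 + θ i ^ 2) - 2 * Y i ω ^ 2
          = (Y i ω ^ 2 - (1 + θ i ^ 2)) ^ 2 / (1 + θ i ^ 2) := by field_simp; ring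
      have e3 : 0 ≤ (Y i ω ^ 2 - (1 + θ i ^ 2)) ^ 2 / (1 + θ i ^ 2) := by positivity
      linarith
    have e4 := integral_mono (hzL i).integrable_sq
      (((h4 i).const_mul (1 / (1 + θ i ^ 2))).add (integrable_const _)) e
    refine e4.trans ?_
    simp only [Pi.add_apply]
    rw [integral_add ((h4 i).const_mul _) (integrable_const _), integral_const_mul]
    simp only [integral_const, probReal_univ, one_smul]
    have e5 : 1 / (1 + θ i ^ 2) * ∫ ω, Y i ω ^ 4 ∂P ≤ K * (1 + θ i ^ 2) := by
      rw [one_div, inv_mul_le_iff₀ hT]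
      refine (hK i).trans ?_
      nlinarith [mul_nonneg hK0 (sq_nonneg (θ i))]
    nlinarith [sq_nonneg (θ i)]
  have hind' : ∀ f : ℕ → ℝ → ℝ, (∀ i, Measurable (f i)) → iIndepFun (fun i ω => f i (Y i ω)) P :=
    fun f hf => hind.comp f hf
  choose Ma hMaL hMa0 hMa2 hMa using fun p => exists_weighted_sum_bound
    (fun i => (hfa i).comp (hm i)) (hind' fa hfa) haL ha0 τ p
  choose Mb hMbL hMb0 hMb2 hMb using fun p => exists_weighted_sum_bound
    (fun i => (hfb i).comp (hm i)) (hind' fb hfb) hbL hb0 τ p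
  choose Mz hMzL hMz0 hMz2 hMz using fun p => exists_weighted_sum_bound
    (fun i => (hfz i).comp (hm i)) (hind' fz hfz) hzL hz0 τ p
  have hXL := memLp_maxAbs hm hY2
  let X : ℕ → Ω → ℝ := fun p ω => maxAbs p fun i => Y i ω
  have hX0 : ∀ p ω, 0 ≤ X p ω := fun p ω => maxAbs_nonneg _ _
  let U : ℕ → Ω → ℝ := fun p ω => 1 / (p : ℝ) * (Ma p ω + 2 * Mb p ω + 2 * (X p ω * Mz p ω))
  have hUint : ∀ p, Integrable (U p) P := fun p =>
    ((((hMaL p).integrable (by norm_num)).add (((hMbL p).integrable (by norm_num)).const_mul 2)).add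
      (((hXL p).integrable_mul (hMzL p)).const_mul 2)).const_mul _
  have hU0 : ∀ p ω, 0 ≤ U p ω := fun p ω => by
    have := hMa0 p ω
    have := hMb0 p ω
    have := hMz0 p ω
    have := hX0 p ω
    simp only [U]; positivity
  refine ⟨U, hUint, hU0, ?_, fun p ω γ μ hμ => ?_⟩
  · obtain ⟨R, hR0, hR⟩ := exists_sum_sq_le hsum
    set D : ℝ := 2 + 24 * (C * (1 + K)) + K + 16 * (K + 3) * R with hD
    have hD0 : 0 < D := by positivity
    have key : ∀ δ : ℝ, 0 < δ → δ ≤ 1 → ∀ᶠ p : ℕ in atTop, ∫ ω, U p ω ∂P ≤ D * δ := by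
      intro δ hδ hδ1
      -- Taking `ε = δ ^ 4` leaves a factor `δ` after the division by `δ ^ 3` in `bound_le_of_pos`.
      filter_upwards [hR, eventually_sum_pow_four_le hsum (ε := δ ^ 4) (by positivity),
        eventually_gt_atTop 0] with p hRp hQp hp
      have hp' : (0 : ℝ) < p := by exact_mod_cast hp
      have hA : ∫ ω, Ma p ω ^ 2 ∂P ≤ 16 * (C * (1 + K) * (δ ^ 4 * (p : ℝ) ^ 2)) := by
        refine (hMa2 p).trans ?_
        gcongr
        refine (Finset.sum_le_sum fun i _ => integral_sq_le_of_sq_le (haL i) hC0 (h4 i) (hK i)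
          fun ω => ha2 i _).trans ?_
        rw [← Finset.mul_sum]; gcongr
      have hB : ∫ ω, Mb p ω ^ 2 ∂P ≤ 16 * (C * (1 + K) * (δ ^ 4 * (p : ℝ) ^ 2)) := by
        refine (hMb2 p).trans ?_
        gcongr
        refine (Finset.sum_le_sum fun i _ => integral_sq_le_of_sq_le (hbL i) hC0 (h4 i) (hK i)
          fun ω => hb2 i _).trans ?_
        rw [← Finset.mul_sum]; gcongr
      have hZ : ∫ ω, Mz p ω ^ 2 ∂P ≤ 16 * ((K + 3) * (R * p)) := by
        refine (hMz2 p).trans ?_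
        gcongr
        refine (Finset.sum_le_sum fun i _ => hz2 i).trans ?_
        rw [← Finset.mul_sum]; gcongr
      have hS : ∑ i ∈ Finset.range p, ∫ ω, Y i ω ^ 4 ∂P ≤ K * (δ ^ 4 * (p : ℝ) ^ 2) := by
        refine (Finset.sum_le_sum fun i _ => hK i).trans ?_
        rw [← Finset.mul_sum]; gcongr
      have iA := (hMaL p).integrable_sq.const_mul (1 / (2 * δ * (p : ℝ) ^ 2))
      have iB := (hMbL p).integrable_sq.const_mul (1 / (δ * (p : ℝ) ^ 2))
      have iS := (integrable_finsetSum (Finset.range p) fun i _ => h4 i).const_mul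
        (1 / (2 * δ ^ 3 * (p : ℝ) ^ 2))
      have iZ := (hMzL p).integrable_sq.const_mul (δ / (p : ℝ))
      have jA : Integrable (fun ω => 2 * δ + 1 / (2 * δ * (p : ℝ) ^ 2) * Ma p ω ^ 2) P :=
        (integrable_const _).add iA
      have jB : Integrable (fun ω => 2 * δ + 1 / (2 * δ * (p : ℝ) ^ 2) * Ma p ω ^ 2
          + 1 / (δ * (p : ℝ) ^ 2) * Mb p ω ^ 2) P := jA.add iB
      have jS : Integrable (fun ω => 2 * δ + 1 / (2 * δ * (p : ℝ) ^ 2) * Ma p ω ^ 2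
          + 1 / (δ * (p : ℝ) ^ 2) * Mb p ω ^ 2
          + 1 / (2 * δ ^ 3 * (p : ℝ) ^ 2) * ∑ i ∈ Finset.range p, Y i ω ^ 4) P := jB.add iS
      have hle := integral_mono (hUint p) (jS.add iZ)
        fun ω => bound_le_of_pos hp' hδ (maxAbs_pow_four_le hp fun i => Y i ω)
      simp only [Pi.add_apply] at hle
      generalize ∫ ω, U p ω ∂P = I at hle ⊢
      rw [integral_add jS iZ, integral_add jB iS, integral_add jA iB,
        integral_add (integrable_const (2 * δ)) iA, integral_const, probReal_univ, one_smul,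
        integral_const_mul, integral_const_mul, integral_const_mul, integral_const_mul,
        integral_finsetSum _ fun i _ => h4 i] at hle
      refine hle.trans ?_
      have tA : 1 / (2 * δ * (p : ℝ) ^ 2) * ∫ ω, Ma p ω ^ 2 ∂P ≤ 8 * (C * (1 + K)) * δ ^ 3 := by
        refine (mul_le_mul_of_nonneg_left hA (by positivity)).trans (le_of_eq ?_)
        field_simp; ring
      have tB : 1 / (δ * (p : ℝ) ^ 2) * ∫ ω, Mb p ω ^ 2 ∂P ≤ 16 * (C * (1 + K)) * δ ^ 3 := by
        refine (mul_le_mul_of_nonneg_left hB (by positivity)).trans (le_of_eq ?_)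
        field_simp
      have tS : 1 / (2 * δ ^ 3 * (p : ℝ) ^ 2) * ∑ i ∈ Finset.range p, ∫ ω, Y i ω ^ 4 ∂P
          ≤ K / 2 * δ := by
        refine (mul_le_mul_of_nonneg_left hS (by positivity)).trans (le_of_eq ?_)
        field_simp
      have tZ : δ / (p : ℝ) * ∫ ω, Mz p ω ^ 2 ∂P ≤ 16 * (K + 3) * R * δ := by
        refine (mul_le_mul_of_nonneg_left hZ (by positivity)).trans (le_of_eq ?_)
        field_simp
      have hδ3 : δ ^ 3 ≤ δ := pow_le_of_le_one hδ.le hδ1 (by norm_num)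
      have hCK : 0 ≤ C * (1 + K) := by positivity
      have := mul_le_mul_of_nonneg_left hδ3 hCK
      have := mul_nonneg hK0 hδ.le
      rw [hD]
      nlinarith
    rw [tendsto_order]
    refine ⟨fun a ha => Eventually.of_forall fun p =>
      ha.trans_le (integral_nonneg fun ω => hU0 p ω), fun a ha => ?_⟩
    filter_upwards [key (min 1 (a / (2 * D))) (by positivity) (min_le_left _ _)] with p hp
    refine hp.trans_lt ?_
    calc D * min 1 (a / (2 * D)) ≤ D * (a / (2 * D)) := by gcongr; exact min_le_right _ _
      _ = a / 2 := by field_simp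
      _ < a := by linarith
  · rw [URE_sub_loss F p hτ, abs_mul, abs_of_nonneg (by positivity : (0 : ℝ) ≤ 1 / p)]
    refine mul_le_mul_of_nonneg_left ?_ (by positivity)
    have ea := hMa p ω (fun _ => 1) (fun _ _ _ => le_rfl) (fun _ => zero_le_one) fun _ => le_rfl
    have hw : ∀ i j, τ i ≤ τ j → shrinkWeight (τ j) γ ≤ shrinkWeight (τ i) γ := fun i j hij =>
      shrinkWeight_anti (hτ i) hij γ
    have eb := hMb p ω (fun i => shrinkWeight (τ i) γ) hw (fun i => shrinkWeight_nonneg (hτ i) γ)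
      fun i => shrinkWeight_le_one (hτ i) γ
    have ez := hMz p ω (fun i => shrinkWeight (τ i) γ) hw (fun i => shrinkWeight_nonneg (hτ i) γ)
      fun i => shrinkWeight_le_one (hτ i) γ
    -- The only place where `|μ| ≤ max |Yᵢ|` enters the bound.
    have exz := mul_le_mul hμ ez (abs_nonneg _) (hX0 p ω)
    rw [← abs_mul, abs_le] at exz
    rw [abs_le] at ea eb ⊢
    simp only [fa, fb, fz, va, Function.comp_apply] at ea eb exz
    simp only [X]
    constructor <;> linarith [ea.1, ea.2, eb.1, eb.2, exz.1, exz.2]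

/-! ### From the uniform bound to asymptotic optimality -/

/-- For nonnegative data, replacing a negative location by 0 brings it closer to every observation,
and the remaining terms do not involve `μ`. -/
theorem URE_max_zero_le (F : Family) {p : ℕ} (τ : ℕ → ℝ) {y : ℕ → ℝ} (hy : ∀ i < p, 0 ≤ y i)
    (γ : ℝ≥0∞) (μ : ℝ) : URE F p τ y γ (max μ 0) ≤ URE F p τ y γ μ := by
  unfold URE
  refine mul_le_mul_of_nonneg_left (Finset.sum_le_sum fun i hi => ?_) (by positivity)
  refine add_le_add (mul_le_mul_of_nonneg_left ?_ (sq_nonneg _)) le_rfl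
  have := hy i (Finset.mem_range.1 hi)
  rcases le_total μ 0 with h | h
  · rw [max_eq_right h]; nlinarith
  · rw [max_eq_left h]

/-- Moving the location into `Θ` does not increase the risk estimate. -/
theorem exists_mem_searchSet_URE_le (F : Family) {p : ℕ} (hp : 0 < p) (τ : ℕ → ℝ) {y : ℕ → ℝ}
    (hy : ∀ i < p, y i ∈ F.meanSpace) (γ : ℝ≥0∞) {μ : ℝ} (hμ : |μ| ≤ maxAbs p y) :
    ∃ μ', (γ, μ') ∈ searchSet F p y ∧ URE F p τ y γ μ' ≤ URE F p τ y γ μ := by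
  have habs : |max μ 0| ≤ |μ| := by
    rw [abs_of_nonneg (le_max_right μ 0)]
    exact max_le (le_abs_self μ) (abs_nonneg μ)
  have hnn : ∀ {F : Family}, F.meanSpace = Set.Ici 0 → (∀ i < p, y i ∈ F.meanSpace) →
      ∃ μ', (γ, μ') ∈ searchSet F p y ∧ URE F p τ y γ μ' ≤ URE F p τ y γ μ := by
    intro F hF hy
    have hmem : max μ 0 ∈ F.meanSpace := by rw [hF]; exact Set.mem_Ici.2 (le_max_right _ _)
    refine ⟨max μ 0, ⟨habs.trans hμ, hmem⟩, URE_max_zero_le F τ (fun i hi => ?_) γ μ⟩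
    have := hy i hi
    rwa [hF] at this
  cases F with
  | binomial =>
    refine ⟨max μ 0, ⟨habs.trans hμ, le_max_right _ _, ?_⟩,
      URE_max_zero_le _ τ (fun i hi => (hy i hi).1) γ μ⟩
    -- The upper constraint `μ ≤ 1` is automatic, since `max |yᵢ| ≤ 1`.
    obtain ⟨i, hi, h⟩ := exists_maxAbs_eq hp y
    have h1 := hy i hi
    refine (le_abs_self _).trans (habs.trans (hμ.trans ?_))
    rw [h, abs_of_nonneg h1.1]
    exact h1.2
  | poisson => exact hnn rfl hy
  | negBinomial => exact hnn rfl hy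
  | gamma α => exact hnn rfl hy
  | ghs α => exact ⟨μ, ⟨hμ, Set.mem_univ _⟩, le_rfl⟩

/-- The properties of the law `Q` of one observation with convolution parameter `τ` and mean `θ`
that enter the asymptotic optimality. -/
structure MomentBound (F : Family) (τ θ K : ℝ) (Q : Measure ℝ) : Prop where
  pos : 0 < τ
  pos' : 0 < τ + F.nu2
  integrable : Integrable (fun x => x ^ 4) Q
  mean : ∫ x, x ∂Q = θ
  second : ∫ x, x ^ 2 ∂Q = θ ^ 2 + F.V θ / τ
  fourth : ∫ x, x ^ 4 ∂Q ≤ K * (1 + θ ^ 4)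
  variance_le : ∀ y, |F.V y / (τ + F.nu2)| ≤ K * (1 + y ^ 2)
  support : ∀ᵐ x ∂Q, x ∈ F.meanSpace

theorem integrable_randomLoss [IsProbabilityMeasure P] {p : ℕ} {τ θ : ℕ → ℝ} {Y : ℕ → Ω → ℝ}
    (hm : ∀ i, Measurable (Y i)) (hL : ∀ i, MemLp (Y i) 2 P) (hτ : ∀ i, 0 < τ i)
    {γ : Ω → ℝ≥0∞} {μ : Ω → ℝ} (hγ : Measurable γ) (hμ : Measurable μ)
    (hle : ∀ᵐ ω ∂P, |μ ω| ≤ maxAbs p fun i => Y i ω) :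
    Integrable (randomLoss p θ τ Y γ μ) P := by
  unfold randomLoss loss
  refine (integrable_finsetSum _ fun i _ => ?_).const_mul _
  have hd : Measurable fun ω => dataWeight (τ i) (γ ω) :=
    (continuous_dataWeight (hτ i)).measurable.comp hγ
  have hs : Measurable fun ω => shrinkWeight (τ i) (γ ω) := by
    simp only [shrinkWeight_eq (hτ i)]; fun_prop
  have hg : Integrable (fun ω => 3 * ((maxAbs p fun i => Y i ω) ^ 2 + Y i ω ^ 2 + θ i ^ 2)) P :=
    (((memLp_maxAbs hm hL p).integrable_sq.add (hL i).integrable_sq).add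
      (integrable_const _)).const_mul 3
  have hYi := hm i
  refine hg.mono' (by unfold estimate; fun_prop) ?_
  filter_upwards [hle] with ω hω
  rw [Real.norm_of_nonneg (sq_nonneg _)]
  unfold estimate
  have hd0 := dataWeight_nonneg (hτ i) (γ ω)
  have hs0 := shrinkWeight_nonneg (hτ i) (γ ω)
  have hs1 := shrinkWeight_le_one (hτ i) (γ ω)
  have hds : dataWeight (τ i) (γ ω) = 1 - shrinkWeight (τ i) (γ ω) := by
    rw [shrinkWeight_eq (hτ i)]; ring
  set d := dataWeight (τ i) (γ ω)
  set s := shrinkWeight (τ i) (γ ω)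
  have h1 : (d * Y i ω) ^ 2 ≤ Y i ω ^ 2 := by
    rw [mul_pow]; exact mul_le_of_le_one_left (sq_nonneg _) (pow_le_one₀ hd0 (by linarith))
  have h2 : (s * μ ω) ^ 2 ≤ (maxAbs p fun i => Y i ω) ^ 2 := by
    rw [mul_pow]
    refine (mul_le_of_le_one_left (sq_nonneg _) (pow_le_one₀ hs0 hs1)).trans ?_
    rw [← sq_abs]; exact pow_le_pow_left₀ (abs_nonneg _) hω 2
  nlinarith [sq_nonneg (d * Y i ω - s * μ ω), sq_nonneg (d * Y i ω + θ i),
    sq_nonneg (s * μ ω + θ i)]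

theorem asymptotic_optimality [IsProbabilityMeasure P] {F : Family} {τ θ : ℕ → ℝ} {Y : ℕ → Ω → ℝ}
    (hm : ∀ i, Measurable (Y i)) (hind : iIndepFun Y P) {K : ℝ}
    (hQ : ∀ i, MomentBound F (τ i) (θ i) K (P.map (Y i)))
    (hsum : (fun p : ℕ => ∑ i ∈ Finset.range p, |θ i| ^ 3) =O[atTop] fun p : ℕ => (p : ℝ))
    {γPM : ℕ → Ω → ℝ≥0∞} {μPM : ℕ → Ω → ℝ}
    (hγPM : ∀ p, Measurable (γPM p)) (hμPM : ∀ p, Measurable (μPM p))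
    (hPM : ∀ p, 0 < p → ∀ᵐ ω ∂P, IsUREMinimizer F p τ (fun i => Y i ω) (γPM p ω) (μPM p ω))
    {γ : ℕ → Ω → ℝ≥0∞} {μ : ℕ → Ω → ℝ}
    (hγ : ∀ p, Measurable (γ p)) (hμ : ∀ p, Measurable (μ p))
    (hμmax : ∀ p, 0 < p → ∀ᵐ ω ∂P, |μ p ω| ≤ maxAbs p (fun i => Y i ω)) :
    (∀ ε : ℝ, 0 < ε → Tendsto (fun p : ℕ => P {ω | randomLoss p θ τ Y (γPM p) (μPM p) ω ≥
        randomLoss p θ τ Y (γ p) (μ p) ω + ε}) atTop (𝓝 0)) ∧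
    (∀ p, 0 < p → Integrable (randomLoss p θ τ Y (γPM p) (μPM p)) P ∧
      Integrable (randomLoss p θ τ Y (γ p) (μ p)) P) ∧
    limsup (fun p : ℕ =>
      ((risk P p θ τ Y (γPM p) (μPM p) - risk P p θ τ Y (γ p) (μ p) : ℝ) : EReal)) atTop ≤ 0 := by
  have hτ : ∀ i, 0 < τ i := fun i => (hQ i).pos
  have h4 : ∀ i, Integrable (fun ω => Y i ω ^ 4) P := fun i =>
    (integrable_map_measure (f := Y i) (g := fun x : ℝ => x ^ 4)
      (by fun_prop) (hm i).aemeasurable).1 (hQ i).integrable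
  have hint : ∀ i (k : ℕ), ∫ x, x ^ k ∂(P.map (Y i)) = ∫ ω, Y i ω ^ k ∂P := fun i k =>
    integral_map (hm i).aemeasurable (by fun_prop)
  have h1 : ∀ i, ∫ ω, Y i ω ∂P = θ i := fun i => by
    have := hint i 1
    simp only [pow_one] at this
    rw [← this, (hQ i).mean]
  have h2 : ∀ i, ∫ ω, Y i ω ^ 2 ∂P = θ i ^ 2 + F.V (θ i) / τ i := fun i => by
    rw [← hint, (hQ i).second]
  have hK : ∀ i, ∫ ω, Y i ω ^ 4 ∂P ≤ K * (1 + θ i ^ 4) := fun i => by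
    rw [← hint]; exact (hQ i).fourth
  have hsupp : ∀ᵐ ω ∂P, ∀ i, Y i ω ∈ F.meanSpace :=
    ae_all_iff.2 fun i => ae_of_ae_map (hm i).aemeasurable (hQ i).support
  have hL : ∀ i, MemLp (Y i) 2 P := fun i => memLp_two_of_integrable_pow_four (hm i) (h4 i)
  obtain ⟨U, hUint, hU0, hUlim, hU⟩ := exists_uniform_bound hm hind hτ (fun i => (hQ i).pos') h4 h1
    h2 hK (fun i => (hQ i).variance_le) hsum
  have hPMmax : ∀ p, 0 < p → ∀ᵐ ω ∂P, |μPM p ω| ≤ maxAbs p (fun i => Y i ω) := fun p hp => by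
    filter_upwards [hPM p hp] with ω hω using hω.1.1
  have hI1 : ∀ p, 0 < p → Integrable (randomLoss p θ τ Y (γPM p) (μPM p)) P := fun p hp =>
    integrable_randomLoss hm hL hτ (hγPM p) (hμPM p) (hPMmax p hp)
  have hI2 : ∀ p, 0 < p → Integrable (randomLoss p θ τ Y (γ p) (μ p)) P := fun p hp =>
    integrable_randomLoss hm hL hτ (hγ p) (hμ p) (hμmax p hp)
  have hle : ∀ p, 0 < p → ∀ᵐ ω ∂P, randomLoss p θ τ Y (γPM p) (μPM p) ω ≤
      randomLoss p θ τ Y (γ p) (μ p) ω + 2 * U p ω := by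
    intro p hp
    filter_upwards [hPM p hp, hμmax p hp, hsupp] with ω hω hω2 hω3
    -- The competitor need not lie in `Θ`, so minimality is applied at `μ'`. The chain is loss(PM) ≤
    -- URE(PM) + U ≤ URE(γ, μ') + U ≤ URE(γ, μ) + U ≤ loss(γ, μ) + 2U.
    obtain ⟨μ', hμ', hle'⟩ := exists_mem_searchSet_URE_le F hp τ (fun i _ => hω3 i) (γ p ω) hω2
    have e1 := hω.2 hμ'
    simp only [Set.mem_ofPred_eq] at e1
    have e2 := abs_le.1 (hU p ω (γPM p ω) (μPM p ω) hω.1.1)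
    have e3 := abs_le.1 (hU p ω (γ p ω) (μ p ω) hω2)
    unfold randomLoss
    linarith [e2.1, e3.2]
  refine ⟨fun ε hε => ?_, fun p hp => ⟨hI1 p hp, hI2 p hp⟩, ?_⟩
  · have hlim : Tendsto (fun p => ENNReal.ofReal (2 / ε * ∫ ω, U p ω ∂P)) atTop (𝓝 0) := by
      have := ENNReal.tendsto_ofReal (hUlim.const_mul (2 / ε))
      simpa using this
    refine tendsto_of_tendsto_of_tendsto_of_le_of_le' tendsto_const_nhds hlim
      (Eventually.of_forall fun _ => zero_le) ?_
    filter_upwards [eventually_gt_atTop 0] with p hp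
    have e1 : P {ω | randomLoss p θ τ Y (γPM p) (μPM p) ω ≥
        randomLoss p θ τ Y (γ p) (μ p) ω + ε} ≤ P {ω | ε / 2 ≤ U p ω} := by
      refine measure_mono_ae ?_
      filter_upwards [hle p hp] with ω hω hω'
      change _ ≥ _ at hω'
      change ε / 2 ≤ U p ω
      linarith
    refine e1.trans ?_
    have e2 := mul_meas_ge_le_integral_of_nonneg (ae_of_all _ (hU0 p)) (hUint p) (ε / 2)
    rw [← ofReal_measureReal]
    refine ENNReal.ofReal_le_ofReal ?_
    rw [← le_div_iff₀' (by positivity)] at e2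
    refine e2.trans (le_of_eq ?_)
    field_simp
  · have hlim : Tendsto (fun p => ((2 * ∫ ω, U p ω ∂P : ℝ) : EReal)) atTop (𝓝 0) := by
      have := hUlim.const_mul 2
      rw [mul_zero] at this
      exact (continuous_coe_real_ereal.tendsto 0).comp this
    rw [← hlim.limsup_eq]
    refine limsup_le_limsup ?_
    filter_upwards [eventually_gt_atTop 0] with p hp
    rw [EReal.coe_le_coe_iff]
    unfold risk
    rw [← integral_sub (hI1 p hp) (hI2 p hp), ← integral_const_mul]
    refine integral_mono_ae ((hI1 p hp).sub (hI2 p hp)) ((hUint p).const_mul 2) ?_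
    filter_upwards [hle p hp] with ω hω
    linarith

/-! ### Moments of the discrete families -/

section Discrete

variable {μ : Measure ℕ} {τ θ κ : ℝ}

theorem integrable_nat_iff_summable [IsFiniteMeasure μ] {f : ℕ → ℝ} :
    Integrable f μ ↔ Summable fun k => μ.real {k} * ‖f k‖ := by
  conv_lhs => rw [← Measure.sum_smul_dirac μ]
  exact integrable_sum_dirac_iff fun k => measure_ne_top μ _

theorem summable_of_integrable_nat [IsFiniteMeasure μ] {f : ℕ → ℝ} (hf : Integrable f μ) :
    Summable fun k => μ.real {k} * f k := by
  refine Summable.of_norm ?_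
  simpa [abs_mul, abs_of_nonneg measureReal_nonneg] using integrable_nat_iff_summable.1 hf

/-- The Stein identity of a law on `ℕ` whose point masses satisfy a linear first order recursion. -/
theorem integral_mul_eq_of_recursion [IsFiniteMeasure μ] {s a b : ℝ}
    (hrec : ∀ k : ℕ, s * ((k + 1) * μ.real {k + 1}) = (a + b * k) * μ.real {k}) {g : ℕ → ℝ}
    (hg : Integrable (fun k : ℕ => k * g k) μ)
    (hg' : Integrable (fun k : ℕ => (a + b * k) * g (k + 1)) μ) :
    s * ∫ k, k * g k ∂μ = ∫ k, (a + b * k) * g (k + 1) ∂μ := by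
  rw [integral_countable hg, integral_countable hg']
  simp only [smul_eq_mul]
  -- The term at 0 vanishes because of the factor `k`; after the shift the recursion applies
  -- termwise.
  rw [(summable_of_integrable_nat hg).tsum_eq_zero_add]
  simp only [Nat.cast_zero, zero_mul, mul_zero, zero_add]
  rw [← tsum_mul_left]
  refine tsum_congr fun k => ?_
  have := hrec k
  push_cast
  linear_combination g (k + 1) * this

/-- A law on `ℕ` with mean `τ θ` whose variance is `τ (θ + κ θ ^ 2)`, given by the recursion of its
point masses. -/
structure IsPanjer (τ θ κ : ℝ) (μ : Measure ℕ) : Prop where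
  prob : IsProbabilityMeasure μ
  recursion : ∀ k : ℕ,
    (1 + κ * θ) * ((k + 1) * μ.real {k + 1}) = (τ * θ + κ * θ * k) * μ.real {k}
  integrable : Integrable (fun k : ℕ => (k : ℝ) ^ 4) μ

theorem IsPanjer.integrable_pow (h : IsPanjer τ θ κ μ) {j : ℕ} (hj : j ≤ 4) :
    Integrable (fun k : ℕ => (k : ℝ) ^ j) μ := by
  have := h.prob
  refine ((integrable_const (1 : ℝ)).add h.integrable).mono' (by fun_prop) (ae_of_all _ fun k => ?_)
  rw [Real.norm_of_nonneg (by positivity)]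
  simp only [Pi.add_apply]
  rcases Nat.eq_zero_or_pos k with rfl | hk
  · rcases Nat.eq_zero_or_pos j with rfl | hj
    · simp
    · simp [hj.ne']
  · have : (k : ℝ) ^ j ≤ (k : ℝ) ^ 4 := pow_le_pow_right₀ (by exact_mod_cast hk) hj
    linarith

theorem IsPanjer.integral_poly (h : IsPanjer τ θ κ μ) (c0 c1 c2 c3 c4 : ℝ) :
    Integrable (fun k : ℕ => c0 + c1 * (k : ℝ) + c2 * (k : ℝ) ^ 2 + c3 * (k : ℝ) ^ 3
      + c4 * (k : ℝ) ^ 4) μ ∧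
    ∫ k : ℕ, (c0 + c1 * (k : ℝ) + c2 * (k : ℝ) ^ 2 + c3 * (k : ℝ) ^ 3 + c4 * (k : ℝ) ^ 4) ∂μ
      = c0 + c1 * ∫ k : ℕ, (k : ℝ) ∂μ + c2 * ∫ k : ℕ, (k : ℝ) ^ 2 ∂μ
        + c3 * ∫ k : ℕ, (k : ℝ) ^ 3 ∂μ + c4 * ∫ k : ℕ, (k : ℝ) ^ 4 ∂μ := by
  have := h.prob
  have i0 : Integrable (fun _ : ℕ => c0) μ := integrable_const _
  have i1 : Integrable (fun k : ℕ => c1 * (k : ℝ)) μ := by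
    simpa using (h.integrable_pow (j := 1) (by norm_num)).const_mul c1
  have i2 := (h.integrable_pow (j := 2) (by norm_num)).const_mul c2
  have i3 := (h.integrable_pow (j := 3) (by norm_num)).const_mul c3
  have i4 := (h.integrable_pow (j := 4) (by norm_num)).const_mul c4
  have j1 : Integrable (fun k : ℕ => c0 + c1 * (k : ℝ)) μ := i0.add i1
  have j2 : Integrable (fun k : ℕ => c0 + c1 * (k : ℝ) + c2 * (k : ℝ) ^ 2) μ := j1.add i2
  have j3 : Integrable (fun k : ℕ => c0 + c1 * (k : ℝ) + c2 * (k : ℝ) ^ 2 + c3 * (k : ℝ) ^ 3) μ :=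
    j2.add i3
  refine ⟨j3.add i4, ?_⟩
  rw [integral_add j3 i4, integral_add j2 i3, integral_add j1 i2, integral_add i0 i1,
    integral_const_mul, integral_const_mul, integral_const_mul, integral_const_mul]
  simp

/-- The top term `κθ k^(j+1)` on the right cancels the `κθ` on the left, so each moment is
determined by lower ones. -/
theorem IsPanjer.stein (h : IsPanjer τ θ κ μ) (j : ℕ) (hj : j ≤ 3) :
    (1 + κ * θ) * ∫ k : ℕ, (k : ℝ) ^ (j + 1) ∂μ
      = ∫ k : ℕ, (τ * θ + κ * θ * k) * ((k : ℝ) + 1) ^ j ∂μ := by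
  have := h.prob
  have h1 := integral_mul_eq_of_recursion h.recursion (g := fun k : ℕ => (k : ℝ) ^ j) ?_ ?_
  · simpa [pow_succ'] using h1
  · simpa [pow_succ'] using h.integrable_pow (j := j + 1) (by omega)
  · push_cast
    have e := h.integral_poly
    interval_cases j
    · convert (e (τ * θ) (κ * θ) 0 0 0).1 using 2; ring
    · convert (e (τ * θ) (τ * θ + κ * θ) (κ * θ) 0 0).1 using 2; ring
    · convert (e (τ * θ) (2 * τ * θ + κ * θ) (τ * θ + 2 * κ * θ) (κ * θ) 0).1 using 2; ring
    · convert (e (τ * θ) (3 * τ * θ + κ * θ) (3 * τ * θ + 3 * κ * θ) (τ * θ + 3 * κ * θ)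
        (κ * θ)).1 using 2; ring

theorem IsPanjer.mean (h : IsPanjer τ θ κ μ) : ∫ k : ℕ, (k : ℝ) ∂μ = τ * θ := by
  have h1 := h.stein 0 (by norm_num)
  have h2 := (h.integral_poly (τ * θ) (κ * θ) 0 0 0).2
  simp only [pow_zero, mul_one, zero_add, pow_one] at h1
  simp only [zero_mul, add_zero] at h2
  linarith

theorem IsPanjer.second (h : IsPanjer τ θ κ μ) :
    ∫ k : ℕ, (k : ℝ) ^ 2 ∂μ = θ * (τ + (τ + κ) * (τ * θ)) := by
  have h1 := h.stein 1 (by norm_num)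
  have h2 := (h.integral_poly (τ * θ) (τ * θ + κ * θ) (κ * θ) 0 0).2
  have h3 : ∀ k : ℕ, (τ * θ + κ * θ * k) * ((k : ℝ) + 1) ^ 1 = τ * θ + (τ * θ + κ * θ) * (k : ℝ)
      + κ * θ * (k : ℝ) ^ 2 + 0 * (k : ℝ) ^ 3 + 0 * (k : ℝ) ^ 4 := fun k => by ring
  simp only [h3, h2, h.mean] at h1
  linarith

theorem IsPanjer.third (h : IsPanjer τ θ κ μ) {m1 m2 : ℝ} (hm1 : ∫ k : ℕ, (k : ℝ) ∂μ = m1)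
    (hm2 : ∫ k : ℕ, (k : ℝ) ^ 2 ∂μ = m2) :
    ∫ k : ℕ, (k : ℝ) ^ 3 ∂μ = θ * (τ * (1 + 2 * m1 + m2) + κ * (m1 + 2 * m2)) := by
  have h1 := h.stein 2 (by norm_num)
  have h2 := (h.integral_poly (τ * θ) (2 * τ * θ + κ * θ) (τ * θ + 2 * κ * θ) (κ * θ) 0).2
  have h3 : ∀ k : ℕ, (τ * θ + κ * θ * k) * ((k : ℝ) + 1) ^ 2
      = τ * θ + (2 * τ * θ + κ * θ) * (k : ℝ) + (τ * θ + 2 * κ * θ) * (k : ℝ) ^ 2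
        + κ * θ * (k : ℝ) ^ 3 + 0 * (k : ℝ) ^ 4 := fun k => by ring
  simp only [h3, h2, hm1, hm2] at h1
  linarith

theorem IsPanjer.fourth (h : IsPanjer τ θ κ μ) {m1 m2 m3 : ℝ} (hm1 : ∫ k : ℕ, (k : ℝ) ∂μ = m1)
    (hm2 : ∫ k : ℕ, (k : ℝ) ^ 2 ∂μ = m2) (hm3 : ∫ k : ℕ, (k : ℝ) ^ 3 ∂μ = m3) :
    ∫ k : ℕ, (k : ℝ) ^ 4 ∂μ
      = θ * (τ * (1 + 3 * m1 + 3 * m2 + m3) + κ * (m1 + 3 * m2 + 3 * m3)) := by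
  have h1 := h.stein 3 (by norm_num)
  have h2 := (h.integral_poly (τ * θ) (3 * τ * θ + κ * θ) (3 * τ * θ + 3 * κ * θ)
    (τ * θ + 3 * κ * θ) (κ * θ)).2
  have h3 : ∀ k : ℕ, (τ * θ + κ * θ * k) * ((k : ℝ) + 1) ^ 3
      = τ * θ + (3 * τ * θ + κ * θ) * (k : ℝ) + (3 * τ * θ + 3 * κ * θ) * (k : ℝ) ^ 2
        + (τ * θ + 3 * κ * θ) * (k : ℝ) ^ 3 + κ * θ * (k : ℝ) ^ 4 := fun k => by ring
  simp only [h3, h2, hm1, hm2, hm3] at h1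
  linarith

theorem IsPanjer.fourth_le (h : IsPanjer τ θ κ μ) (hτ : 0 < τ) (hθ : 0 ≤ θ) (hκ1 : κ ≤ 1)
    {W : ℝ} (hW : 1 ≤ W) (hWτ : 1 ≤ W * τ) :
    ∫ k : ℕ, (k : ℝ) ^ 4 ∂μ ≤ 600 * W ^ 3 * τ ^ 4 * (1 + θ ^ 4) := by
  have hm1 := h.mean
  have hm2 := h.second
  rw [← hm1] at hm2
  have hm3 := h.third rfl rfl
  have hm4 := h.fourth rfl rfl rfl
  have p1 : 0 ≤ ∫ k : ℕ, (k : ℝ) ∂μ := integral_nonneg fun k => by positivity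
  have p2 : 0 ≤ ∫ k : ℕ, (k : ℝ) ^ 2 ∂μ := integral_nonneg fun k => by positivity
  have p3 : 0 ≤ ∫ k : ℕ, (k : ℝ) ^ 3 ∂μ := integral_nonneg fun k => by positivity
  generalize ∫ k : ℕ, (k : ℝ) ∂μ = m1 at *
  generalize ∫ k : ℕ, (k : ℝ) ^ 2 ∂μ = m2 at *
  generalize ∫ k : ℕ, (k : ℝ) ^ 3 ∂μ = m3 at *
  rw [hm4]
  -- The `j`-th moment is bounded by a constant times `W^(j-1) T^j`; lower powers are absorbed using
  -- `W * T ≥ 1`, and `κ` using `κ ≤ W * τ`. Finally 600 is `75 * 8`.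
  set T := τ * (1 + θ) with hT
  have hT0 : 0 ≤ T := by positivity
  have hτT : τ * θ ≤ T := by rw [hT]; nlinarith
  have hWT : 1 ≤ W * T := by
    rw [hT]; nlinarith [mul_nonneg (mul_nonneg (zero_le_one.trans hW) hτ.le) hθ]
  have hκW : κ ≤ W * τ := hκ1.trans hWτ
  have key : ∀ x y B : ℝ, 0 ≤ x → 0 ≤ y → x + W * y ≤ B → θ * (τ * x + κ * y) ≤ T * B := by
    intro x y B hx hy hB
    calc θ * (τ * x + κ * y) ≤ θ * (τ * x + (W * τ) * y) := by gcongr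
      _ = (τ * θ) * (x + W * y) := by ring
      _ ≤ T * B := mul_le_mul hτT hB (by positivity) hT0
  have hW0 : 0 ≤ W := by linarith
  have b1 : m1 ≤ T := hm1.le.trans hτT
  have s1 : T ≤ W * T ^ 2 := by nlinarith
  have s2 : 1 ≤ W ^ 2 * T ^ 2 := by nlinarith
  have s3 : W * T ^ 2 ≤ W ^ 2 * T ^ 2 := by
    have : W ≤ W ^ 2 := by nlinarith
    gcongr
  have b2 : m2 ≤ 3 * (W * T ^ 2) := by
    rw [hm2]
    calc θ * (τ + (τ + κ) * m1) = θ * (τ * (1 + m1) + κ * m1) := by ring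
      _ ≤ T * (3 * (W * T)) := key _ _ _ (by positivity) p1 (by nlinarith)
      _ = 3 * (W * T ^ 2) := by ring
  have b3 : m3 ≤ 13 * (W ^ 2 * T ^ 3) := by
    rw [hm3]
    have e1 := mul_le_mul_of_nonneg_left (b1.trans s1) hW0
    have e2 := mul_le_mul_of_nonneg_left b2 hW0
    calc θ * (τ * (1 + 2 * m1 + m2) + κ * (m1 + 2 * m2)) ≤ T * (13 * (W ^ 2 * T ^ 2)) :=
          key _ _ _ (by positivity) (by positivity) (by nlinarith)
      _ = 13 * (W ^ 2 * T ^ 3) := by ring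
  have b4 : θ * (τ * (1 + 3 * m1 + 3 * m2 + m3) + κ * (m1 + 3 * m2 + 3 * m3))
      ≤ 75 * (W ^ 3 * T ^ 4) := by
    have t1 : W ^ 2 * T ^ 2 ≤ W ^ 3 * T ^ 3 := by
      calc W ^ 2 * T ^ 2 ≤ W ^ 2 * T ^ 2 * (W * T) := le_mul_of_one_le_right (by positivity) hWT
        _ = W ^ 3 * T ^ 3 := by ring
    have t2 : W ^ 2 * T ^ 3 ≤ W ^ 3 * T ^ 3 := by
      have : W ^ 2 ≤ W ^ 3 := pow_le_pow_right₀ hW (by norm_num)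
      gcongr
    have t3 : W * (W * T ^ 2) ≤ W ^ 3 * T ^ 3 := by
      calc W * (W * T ^ 2) = W ^ 2 * T ^ 2 := by ring
        _ ≤ _ := t1
    have e1 := mul_le_mul_of_nonneg_left (b1.trans s1) hW0
    have e2 := mul_le_mul_of_nonneg_left b2 hW0
    have e3 := mul_le_mul_of_nonneg_left b3 hW0
    calc _ ≤ T * (75 * (W ^ 3 * T ^ 3)) :=
          key _ _ _ (by positivity) (by positivity) (by nlinarith)
      _ = 75 * (W ^ 3 * T ^ 4) := by ring
  have hθ4 : (1 + θ) ^ 4 ≤ 8 * (1 + θ ^ 4) := by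
    have : (1 + θ) ^ 2 ≤ 2 * (1 + θ ^ 2) := by nlinarith [sq_nonneg (1 - θ)]
    have := pow_le_pow_left₀ (sq_nonneg _) this 2
    nlinarith [sq_nonneg (1 - θ ^ 2)]
  calc _ ≤ 75 * (W ^ 3 * T ^ 4) := b4
    _ = 75 * W ^ 3 * τ ^ 4 * (1 + θ) ^ 4 := by rw [hT]; ring
    _ ≤ 75 * W ^ 3 * τ ^ 4 * (8 * (1 + θ ^ 4)) := by gcongr
    _ = 600 * W ^ 3 * τ ^ 4 * (1 + θ ^ 4) := by ring

/-- The recursion forces a finite fourth moment when it has nonnegative coefficients. -/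
theorem integrable_pow_four_of_recursion [IsFiniteMeasure μ] (hτ : 0 < τ) (hθ : 0 ≤ θ) (hκ : 0 ≤ κ)
    (hrec : ∀ k : ℕ,
      (1 + κ * θ) * ((k + 1) * μ.real {k + 1}) = (τ * θ + κ * θ * k) * μ.real {k}) :
    Integrable (fun k : ℕ => (k : ℝ) ^ 4) μ := by
  rw [integrable_nat_iff_summable]
  -- The limit of the ratios of consecutive terms. It is below 1, so the ratio test applies.
  set r := κ * θ / (1 + κ * θ) with hr
  have hκθ : 0 ≤ κ * θ := by positivity
  have hr1 : r < 1 := by rw [hr, div_lt_one (by positivity)]; linarith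
  obtain ⟨ρ, hρ, hρ1⟩ := exists_between hr1
  have hlim : Tendsto (fun k : ℕ => (1 + 1 / (k : ℝ)) ^ 3
      * ((τ * θ * (1 / (k : ℝ)) + κ * θ) / (1 + κ * θ))) atTop (𝓝 r) := by
    have h0 := tendsto_one_div_atTop_nhds_zero_nat (𝕜 := ℝ)
    have := ((h0.const_add 1).pow 3).mul
      (((h0.const_mul (τ * θ)).add_const (κ * θ)).div_const (1 + κ * θ))
    simpa [hr] using this
  refine summable_of_ratio_norm_eventually_le hρ1 ?_
  filter_upwards [hlim.eventually_lt_const hρ, eventually_gt_atTop 0] with k hk hk0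
  have hk' : (0 : ℝ) < k := by exact_mod_cast hk0
  have hw : 0 ≤ μ.real {k} := measureReal_nonneg
  rw [Real.norm_of_nonneg (by positivity), Real.norm_of_nonneg (by positivity),
    Real.norm_of_nonneg (by positivity), Real.norm_of_nonneg (by positivity)]
  have e1 : ((k : ℝ) + 1) * μ.real {k + 1} = (τ * θ + κ * θ * k) * μ.real {k} / (1 + κ * θ) := by
    rw [eq_div_iff (by positivity), ← hrec k]; ring
  have e2 : μ.real {k + 1} * ((k + 1 : ℕ) : ℝ) ^ 4 = (1 + 1 / (k : ℝ)) ^ 3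
      * ((τ * θ * (1 / (k : ℝ)) + κ * θ) / (1 + κ * θ)) * (μ.real {k} * (k : ℝ) ^ 4) := by
    have : μ.real {k + 1} * ((k + 1 : ℕ) : ℝ) ^ 4
        = ((k : ℝ) + 1) ^ 3 * (((k : ℝ) + 1) * μ.real {k + 1}) := by push_cast; ring
    rw [this, e1]; field_simp
  rw [e2]
  exact mul_le_mul_of_nonneg_right hk.le (by positivity)

end Discrete

theorem abs_V_div_le (F : Family) {τ c : ℝ} (hc : 0 < c) (h : c ≤ τ + F.nu2) (y : ℝ) :
    |F.V y / (τ + F.nu2)| ≤ (|F.nu0| + |F.nu1| + |F.nu2|) / c * (1 + y ^ 2) := by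
  have h1 : |F.V y| ≤ (|F.nu0| + |F.nu1| + |F.nu2|) * (1 + y ^ 2) := by
    have e1 : |F.V y| ≤ |F.nu0| + |F.nu1| * |y| + |F.nu2| * y ^ 2 := by
      unfold Family.V
      refine (abs_add_le _ _).trans (add_le_add ((abs_add_le _ _).trans ?_) ?_)
      · rw [abs_mul]
      · rw [abs_mul, abs_of_nonneg (sq_nonneg y)]
    have e2 : |y| ≤ 1 + y ^ 2 := by
      rw [← sq_abs]; nlinarith [sq_nonneg (|y| - 1), abs_nonneg y]
    have e3 := mul_le_mul_of_nonneg_left e2 (abs_nonneg F.nu1)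
    nlinarith [abs_nonneg F.nu0, abs_nonneg F.nu2, mul_nonneg (abs_nonneg F.nu0) (sq_nonneg y)]
  rw [abs_div, abs_of_pos (hc.trans_le h), div_mul_eq_mul_div]
  gcongr

/-- With `ν₀ = 0`, `ν₁ = 1` and `κ = ν₂`, the count has variance `τ V(θ)`; division by `τ` gives the
required moments. -/
theorem IsPanjer.momentBound {μ : Measure ℕ} {F : Family} {τ θ c K : ℝ}
    (h : IsPanjer τ θ F.nu2 μ) (h0 : F.nu0 = 0) (h1 : F.nu1 = 1) (hτ : 0 < τ) (hc : 0 < c)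
    (hcτ : c ≤ τ + F.nu2) (h4 : ∫ k : ℕ, (k : ℝ) ^ 4 ∂μ ≤ K * τ ^ 4 * (1 + θ ^ 4))
    (hsupp : ∀ᵐ k : ℕ ∂μ, (k : ℝ) / τ ∈ F.meanSpace) (hF : MeasurableSet F.meanSpace) :
    MomentBound F τ θ (max K ((|F.nu0| + |F.nu1| + |F.nu2|) / c))
      (μ.map fun k : ℕ => (k : ℝ) / τ) where
  pos := hτ
  pos' := hc.trans_le hcτ
  integrable := by
    rw [integrable_map_measure (by fun_prop) (by fun_prop)]
    simpa [Function.comp_def, div_pow] using h.integrable.div_const (τ ^ 4)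
  mean := by
    rw [integral_map (by fun_prop) (by fun_prop), integral_div, h.mean]
    field_simp
  second := by
    rw [integral_map (by fun_prop) (by fun_prop)]
    simp only [div_pow]
    rw [integral_div, h.second, Family.V, h0, h1]
    field_simp; ring
  fourth := by
    rw [integral_map (by fun_prop) (by fun_prop)]
    simp only [div_pow]
    rw [integral_div, div_le_iff₀ (by positivity)]
    refine h4.trans ?_
    calc K * τ ^ 4 * (1 + θ ^ 4) = K * ((1 + θ ^ 4) * τ ^ 4) := by ring
      _ ≤ max K ((|F.nu0| + |F.nu1| + |F.nu2|) / c) * ((1 + θ ^ 4) * τ ^ 4) := by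
        gcongr; exact le_max_left _ _
      _ = _ := by ring
  variance_le y := (abs_V_div_le F hc hcτ y).trans (by gcongr; exact le_max_right _ _)
  support := (ae_map_iff (by fun_prop) hF).2 hsupp

theorem isPanjer_poisson {τ θ : ℝ} (hτ : 0 < τ) (hθ : 0 < θ) :
    IsPanjer τ θ 0 (poissonMeasure (τ * θ).toNNReal) := by
  have hrec : ∀ k : ℕ, (1 + 0 * θ) * ((k + 1) * (poissonMeasure (τ * θ).toNNReal).real {k + 1})
      = (τ * θ + 0 * θ * k) * (poissonMeasure (τ * θ).toNNReal).real {k} := by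
    intro k
    rw [poissonMeasure_real_singleton, poissonMeasure_real_singleton,
      Real.coe_toNNReal _ (by positivity), Nat.factorial_succ]
    push_cast
    field_simp; ring
  exact ⟨inferInstance, hrec, integrable_pow_four_of_recursion hτ hθ.le le_rfl hrec⟩

theorem negBinomialMeasure_real_singleton {r q : ℝ} (hr : 0 < r) (hq : 0 < q) (hq1 : q < 1)
    (k : ℕ) :
    (negBinomialMeasure r q).real {k}
      = Real.Gamma (k + r) / (k.factorial * Real.Gamma r) * q ^ k * (1 - q) ^ r := by
  have h1 := Real.Gamma_pos_of_pos (show 0 < k + r by positivity)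
  have h2 := Real.Gamma_pos_of_pos hr
  have h3 : 0 < 1 - q := by linarith
  rw [measureReal_def, negBinomialMeasure, Measure.sum_smul_dirac_singleton,
    ENNReal.toReal_ofReal (by positivity)]

theorem isPanjer_negBinomial {r q : ℝ} (hr : 0 < r) (hq : 0 < q) (hq1 : q < 1)
    (hprob : IsProbabilityMeasure (negBinomialMeasure r q)) :
    IsPanjer r (q / (1 - q)) 1 (negBinomialMeasure r q) := by
  have h3 : 0 < 1 - q := by linarith
  have hrec : ∀ k : ℕ,
      (1 + 1 * (q / (1 - q))) * ((k + 1) * (negBinomialMeasure r q).real {k + 1})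
      = (r * (q / (1 - q)) + 1 * (q / (1 - q)) * k) * (negBinomialMeasure r q).real {k} := by
    intro k
    rw [negBinomialMeasure_real_singleton hr hq hq1, negBinomialMeasure_real_singleton hr hq hq1,
      Nat.factorial_succ]
    have h4 : Real.Gamma (((k + 1 : ℕ) : ℝ) + r) = (k + r) * Real.Gamma (k + r) := by
      rw [← Real.Gamma_add_one (by positivity)]; push_cast; ring_nf
    have h2 := Real.Gamma_pos_of_pos hr
    rw [h4]
    generalize (1 - q) ^ r = A
    push_cast
    field_simp; ring
  exact ⟨hprob, hrec, integrable_pow_four_of_recursion hr (by positivity) zero_le_one hrec⟩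

theorem isPanjer_binomial (n : ℕ) (q : unitInterval) :
    IsPanjer n q (-1) (ProbabilityTheory.binomial n q) where
  prob := inferInstance
  recursion k := by
    rw [binomial_real_singleton, binomial_real_singleton]
    -- At `k = n` the factor `nq - qk` vanishes; beyond `n` all masses are zero.
    rcases lt_trichotomy k n with hk | rfl | hk
    · obtain ⟨m, rfl⟩ : ∃ m, n = k + 1 + m := ⟨n - (k + 1), by omega⟩
      have e : ((k + 1 + m).choose (k + 1) : ℝ) * (k + 1) = (k + 1 + m).choose k * (m + 1) := by
        have := Nat.choose_succ_right_eq (k + 1 + m) k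
        rw [show k + 1 + m - k = m + 1 by omega] at this
        exact_mod_cast this
      rw [show k + 1 + m - (k + 1) = m by omega, show k + 1 + m - k = m + 1 by omega]
      push_cast
      linear_combination (1 - (q : ℝ)) ^ (m + 1) * (q : ℝ) ^ (k + 1) * e
    · simp only [Nat.choose_self, Nat.choose_succ_self, Nat.sub_self]
      push_cast; ring
    · simp [Nat.choose_eq_zero_of_lt hk, Nat.choose_eq_zero_of_lt (hk.trans (Nat.lt_succ_self k))]
  integrable := integrable_binomial _

/-! ### Moments of the Gamma family -/

/-- Multiplying by `x` raises the shape by one, so moments reduce to total masses of Gamma laws. -/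
theorem mul_gammaPDFReal {a r : ℝ} (ha : 0 < a) (hr : 0 < r) (x : ℝ) :
    gammaPDFReal a r x * x = a / r * gammaPDFReal (a + 1) r x := by
  unfold gammaPDFReal
  rcases lt_trichotomy x 0 with hx | rfl | hx
  · simp [not_le.2 hx]
  · simp [Real.zero_rpow ha.ne']
  · have hG := Real.Gamma_pos_of_pos ha
    rw [if_pos hx.le, if_pos hx.le, Real.Gamma_add_one ha.ne', Real.rpow_add_one hr.ne',
      show a + 1 - 1 = (a - 1) + 1 by ring, Real.rpow_add_one hx.ne']
    field_simp

theorem integrable_gammaMeasure_iff {a r : ℝ} (ha : 0 < a) (hr : 0 < r) {f : ℝ → ℝ} :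
    Integrable f (gammaMeasure a r) ↔ Integrable fun x => gammaPDFReal a r x * f x := by
  unfold gammaMeasure
  rw [integrable_withDensity_iff_integrable_smul' (by unfold gammaPDF; fun_prop)
    (ae_of_all _ fun x => by simp [gammaPDF])]
  simp [gammaPDF, ENNReal.toReal_ofReal (gammaPDFReal_nonneg ha hr _)]

theorem integral_gammaMeasure {a r : ℝ} (ha : 0 < a) (hr : 0 < r) (f : ℝ → ℝ) :
    ∫ x, f x ∂(gammaMeasure a r) = ∫ x, gammaPDFReal a r x * f x := by
  unfold gammaMeasure
  rw [integral_withDensity_eq_integral_toReal_smul (by unfold gammaPDF; fun_prop)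
    (ae_of_all _ fun x => by simp [gammaPDF])]
  simp [gammaPDF, ENNReal.toReal_ofReal (gammaPDFReal_nonneg ha hr _)]

theorem integrable_pow_succ_gammaMeasure {a r : ℝ} (ha : 0 < a) (hr : 0 < r) {k : ℕ}
    (h : Integrable (fun x => x ^ k) (gammaMeasure (a + 1) r)) :
    Integrable (fun x => x ^ (k + 1)) (gammaMeasure a r) := by
  rw [integrable_gammaMeasure_iff ha hr]
  rw [integrable_gammaMeasure_iff (by linarith) hr] at h
  refine (h.const_mul (a / r)).congr (ae_of_all _ fun x => ?_)
  simp only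
  rw [← mul_assoc, ← mul_gammaPDFReal ha hr]; ring

theorem integral_pow_succ_gammaMeasure {a r : ℝ} (ha : 0 < a) (hr : 0 < r) (k : ℕ) :
    ∫ x, x ^ (k + 1) ∂(gammaMeasure a r) = a / r * ∫ x, x ^ k ∂(gammaMeasure (a + 1) r) := by
  rw [integral_gammaMeasure ha hr, integral_gammaMeasure (by linarith) hr, ← integral_const_mul]
  refine integral_congr_ae (ae_of_all _ fun x => ?_)
  simp only
  rw [← mul_assoc, ← mul_gammaPDFReal ha hr]; ring

theorem integrable_pow_gammaMeasure {a r : ℝ} (ha : 0 < a) (hr : 0 < r) (k : ℕ) :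
    Integrable (fun x => x ^ k) (gammaMeasure a r) := by
  induction k generalizing a with
  | zero =>
    have := isProbabilityMeasure_gammaMeasure ha hr
    simp
  | succ k ih => exact integrable_pow_succ_gammaMeasure ha hr (ih (by linarith))

theorem integral_one_gammaMeasure {a r : ℝ} (ha : 0 < a) (hr : 0 < r) :
    ∫ x : ℝ, x ^ 0 ∂(gammaMeasure a r) = 1 := by
  have := isProbabilityMeasure_gammaMeasure ha hr
  simp

theorem gammaMeasure_ae_nonneg (a r : ℝ) : ∀ᵐ x ∂(gammaMeasure a r), 0 ≤ x := by
  unfold gammaMeasure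
  rw [ae_withDensity_iff (by unfold gammaPDF; fun_prop)]
  refine ae_of_all _ fun x hx => ?_
  by_contra hneg
  exact hx (gammaPDF_of_neg (not_le.1 hneg))

theorem momentBound_gamma {α τ η c : ℝ} (hα : 0 < α) (hη : 0 < η) (hc : 0 < c) (hcτ : c ≤ τ) :
    MomentBound (.gamma α) τ (α * η)
      (max ((1 + 3 / (c * α)) ^ 3) ((|(Family.gamma α).nu0| + |(Family.gamma α).nu1|
        + |(Family.gamma α).nu2|) / c))
      ((gammaMeasure (τ * α) (1 / η)).map fun x : ℝ => x / τ) := by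
  have hτ : 0 < τ := hc.trans_le hcτ
  have ha : 0 < τ * α := by positivity
  have hr : 0 < 1 / η := by positivity
  have hnu : (Family.gamma α).nu2 = 1 / α := rfl
  have hcτ' : c ≤ τ + (Family.gamma α).nu2 := by
    have : 0 < 1 / α := by positivity
    rw [hnu]; linarith
  have a1 : 0 < τ * α + 1 := by linarith
  have a2 : 0 < τ * α + 1 + 1 := by linarith
  have a3 : 0 < τ * α + 1 + 1 + 1 := by linarith
  have m1 : ∫ x, x ∂(gammaMeasure (τ * α) (1 / η)) = τ * α * η := by
    have := integral_pow_succ_gammaMeasure ha hr 0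
    rw [integral_one_gammaMeasure a1 hr] at this
    simp only [zero_add, pow_one] at this
    rw [this]; field_simp
  have m2 : ∫ x, x ^ 2 ∂(gammaMeasure (τ * α) (1 / η)) = τ * α * (τ * α + 1) * η ^ 2 := by
    rw [integral_pow_succ_gammaMeasure ha hr 1, integral_pow_succ_gammaMeasure a1 hr 0,
      integral_one_gammaMeasure a2 hr]
    field_simp
  have m4 : ∫ x, x ^ 4 ∂(gammaMeasure (τ * α) (1 / η))
      = τ * α * (τ * α + 1) * (τ * α + 1 + 1) * (τ * α + 1 + 1 + 1) * η ^ 4 := by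
    rw [integral_pow_succ_gammaMeasure ha hr 3, integral_pow_succ_gammaMeasure a1 hr 2,
      integral_pow_succ_gammaMeasure a2 hr 1, integral_pow_succ_gammaMeasure a3 hr 0,
      integral_one_gammaMeasure (by linarith) hr]
    field_simp
  exact
  { pos := hτ
    pos' := hc.trans_le hcτ'
    integrable := by
      rw [integrable_map_measure (by fun_prop) (by fun_prop)]
      simpa [Function.comp_def, div_pow] using
        (integrable_pow_gammaMeasure ha hr 4).div_const (τ ^ 4)
    mean := by
      rw [integral_map (by fun_prop) (by fun_prop), integral_div, m1]
      field_simp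
    second := by
      rw [integral_map (by fun_prop) (by fun_prop)]
      simp only [div_pow]
      rw [integral_div, m2]
      simp only [Family.V, Family.nu0, Family.nu1, Family.nu2]
      field_simp; ring
    fourth := by
      rw [integral_map (by fun_prop) (by fun_prop)]
      simp only [div_pow]
      rw [integral_div, m4, div_le_iff₀ (by positivity)]
      -- Since `τα ≥ cα`, each factor `τα + j` with `j ≤ 3` is at most `L * τα`.
      set L := 1 + 3 / (c * α) with hL
      have hL0 : 0 < L := by positivity
      have key : τ * α + 3 ≤ L * (τ * α) := by
        have : 3 ≤ 3 / (c * α) * (τ * α) := by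
          rw [div_mul_eq_mul_div, le_div_iff₀ (by positivity)]
          nlinarith
        rw [hL]; linarith
      calc τ * α * (τ * α + 1) * (τ * α + 1 + 1) * (τ * α + 1 + 1 + 1) * η ^ 4
          ≤ τ * α * (L * (τ * α)) * (L * (τ * α)) * (L * (τ * α)) * η ^ 4 := by
            gcongr <;> linarith
        _ = L ^ 3 * (α * η) ^ 4 * τ ^ 4 := by ring
        _ ≤ (L ^ 3 * (1 + (α * η) ^ 4)) * τ ^ 4 := by
            gcongr
            linarith
        _ ≤ _ := by
            gcongr
            exact le_max_left _ _
    variance_le := fun y => (abs_V_div_le _ hc hcτ' y).trans (by gcongr; exact le_max_right _ _)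
    support := by
      refine (ae_map_iff (by fun_prop) measurableSet_Ici).2 ?_
      filter_upwards [gammaMeasure_ae_nonneg (τ * α) (1 / η)] with x hx
      exact Set.mem_Ici.2 (div_nonneg hx hτ.le) }

/-! ### Moments of the generalized hyperbolic secant family -/

section GHS

variable {r : ℝ} {ν : Measure ℝ}

/-- A non-integrable exponential would give `mgf` the default value 0, contradicting the positivity
of `(cos t)^(-r)`. -/
theorem mem_interior_integrableExpSet_of_isSymmetricGHS (h : IsSymmetricGHS r ν) {t : ℝ}
    (ht : |t| < Real.pi / 2) : t ∈ interior (integrableExpSet id ν) := by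
  have hsub : Set.Ioo (-(Real.pi / 2)) (Real.pi / 2) ⊆ integrableExpSet id ν := by
    intro s hs
    by_contra hneg
    have h1 := h.2 s (abs_lt.2 hs)
    rw [mgf_undef hneg] at h1
    exact (Real.rpow_pos_of_pos (Real.cos_pos_of_mem_Ioo hs) (-r)).ne h1
  exact interior_maximal hsub isOpen_Ioo (abs_lt.1 ht)

/-- Differentiation under the integral raises the power by one. Since `tan' = 1 + tan²` and
`(cos^(-r))' = r tan cos^(-r)`, the form polynomial in `tan t` times `(cos t)^(-r)` is preserved. -/
theorem integral_pow_mul_exp_eq_of_hasDerivAt (h : IsSymmetricGHS r ν) {k : ℕ} {p q : ℝ → ℝ}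
    (hp : ∀ t, |t| < Real.pi / 2 →
      ∫ x, x ^ k * Real.exp (t * x) ∂ν = p (Real.tan t) * Real.cos t ^ (-r))
    (hd : ∀ u, HasDerivAt p (q u) u) {t : ℝ} (ht : |t| < Real.pi / 2) :
    ∫ x, x ^ (k + 1) * Real.exp (t * x) ∂ν
      = (q (Real.tan t) * (1 + Real.tan t ^ 2) + p (Real.tan t) * (r * Real.tan t))
        * Real.cos t ^ (-r) := by
  have hcos : 0 < Real.cos t := Real.cos_pos_of_mem_Ioo (abs_lt.1 ht)
  have h1 := hasDerivAt_integral_pow_mul_exp_real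
    (mem_interior_integrableExpSet_of_isSymmetricGHS h ht) k
  have htan : HasDerivAt Real.tan (1 + Real.tan t ^ 2) t := by
    have := Real.hasDerivAt_tan hcos.ne'
    convert this using 1
    rw [Real.tan_eq_sin_div_cos]
    field_simp
    linarith [Real.sin_sq_add_cos_sq t]
  have hf : HasDerivAt (fun t => Real.cos t ^ (-r)) (r * Real.tan t * Real.cos t ^ (-r)) t := by
    have := (Real.hasDerivAt_cos t).rpow_const (p := -r) (Or.inl hcos.ne')
    convert this using 1
    rw [Real.rpow_sub_one hcos.ne', Real.tan_eq_sin_div_cos]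
    field_simp
  have h2 : HasDerivAt (fun t => p (Real.tan t) * Real.cos t ^ (-r)) _ t :=
    ((hd (Real.tan t)).comp t htan).mul hf
  have h3 : (fun t => ∫ x, id x ^ k * Real.exp (t * id x) ∂ν)
      =ᶠ[𝓝 t] fun t => p (Real.tan t) * Real.cos t ^ (-r) := by
    have : ∀ᶠ s in 𝓝 t, |s| < Real.pi / 2 :=
      (continuous_abs.tendsto t).eventually_lt_const ht
    filter_upwards [this] with s hs using hp s hs
  have h4 := h1.unique (h2.congr_of_eventuallyEq h3)
  simp only [id] at h4
  rw [h4]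
  simp only [Function.comp_apply]
  ring

theorem integral_pow_mul_exp_of_isSymmetricGHS (h : IsSymmetricGHS r ν) :
    ∀ t, |t| < Real.pi / 2 →
      (∫ x, x * Real.exp (t * x) ∂ν = r * Real.tan t * Real.cos t ^ (-r)) ∧
      (∫ x, x ^ 2 * Real.exp (t * x) ∂ν
        = (r + (r + r ^ 2) * Real.tan t ^ 2) * Real.cos t ^ (-r)) ∧
      (∫ x, x ^ 4 * Real.exp (t * x) ∂ν
        = ((2 * r + 3 * r ^ 2) + (8 * r + 14 * r ^ 2 + 6 * r ^ 3) * Real.tan t ^ 2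
          + (6 * r + 11 * r ^ 2 + 6 * r ^ 3 + r ^ 4) * Real.tan t ^ 4) * Real.cos t ^ (-r)) := by
  have e0 : ∀ t, |t| < Real.pi / 2 →
      ∫ x, x ^ 0 * Real.exp (t * x) ∂ν = (fun _ => 1) (Real.tan t) * Real.cos t ^ (-r) := by
    intro t ht
    have := h.2 t ht
    simpa [mgf] using this
  have e1 : ∀ t, |t| < Real.pi / 2 →
      ∫ x, x ^ 1 * Real.exp (t * x) ∂ν
        = (fun u => r * u) (Real.tan t) * Real.cos t ^ (-r) := by
    intro t ht
    rw [integral_pow_mul_exp_eq_of_hasDerivAt h e0 (q := fun _ => 0)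
      (fun u => hasDerivAt_const u 1) ht]
    ring
  have e2 : ∀ t, |t| < Real.pi / 2 →
      ∫ x, x ^ 2 * Real.exp (t * x) ∂ν
        = (fun u => r + (r + r ^ 2) * u ^ 2) (Real.tan t) * Real.cos t ^ (-r) := by
    intro t ht
    rw [integral_pow_mul_exp_eq_of_hasDerivAt h e1 (q := fun _ => r)
      (fun u => by simpa using (hasDerivAt_id u).const_mul r) ht]
    ring
  have e3 : ∀ t, |t| < Real.pi / 2 →
      ∫ x, x ^ 3 * Real.exp (t * x) ∂ν
        = (fun u => (2 * r + 3 * r ^ 2) * u + (2 * r + 3 * r ^ 2 + r ^ 3) * u ^ 3) (Real.tan t)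
          * Real.cos t ^ (-r) := by
    intro t ht
    rw [integral_pow_mul_exp_eq_of_hasDerivAt h
      (p := fun u => r + (r + r ^ 2) * u ^ 2) e2 (q := fun u => (r + r ^ 2) * (2 * u))
      (fun u => by simpa using ((hasDerivAt_pow 2 u).const_mul (r + r ^ 2)).const_add r) ht]
    ring
  intro t ht
  refine ⟨by simpa using e1 t ht, e2 t ht, ?_⟩
  rw [integral_pow_mul_exp_eq_of_hasDerivAt h
    (p := fun u => (2 * r + 3 * r ^ 2) * u + (2 * r + 3 * r ^ 2 + r ^ 3) * u ^ 3) e3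
    (q := fun u => (2 * r + 3 * r ^ 2) + (2 * r + 3 * r ^ 2 + r ^ 3) * (3 * u ^ 2))
    (fun u => (by simpa using (hasDerivAt_id u).const_mul (2 * r + 3 * r ^ 2) :
      HasDerivAt (fun u => (2 * r + 3 * r ^ 2) * u) (2 * r + 3 * r ^ 2) u).add
      (by simpa using (hasDerivAt_pow 3 u).const_mul (2 * r + 3 * r ^ 2 + r ^ 3))) ht]
  ring

/-- At `t = arctan l` one has `tan t = l`, and the normalizing constant of the tilt cancels `(cos
t)^(-r)`. -/
theorem integral_pow_of_isGHS {l : ℝ} {G : Measure ℝ} (h : IsGHS r l G) :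
    Integrable (fun x => x ^ 4) G ∧ ∫ x, x ∂G = r * l ∧
      ∫ x, x ^ 2 ∂G = r + (r + r ^ 2) * l ^ 2 ∧
      ∫ x, x ^ 4 ∂G = (2 * r + 3 * r ^ 2) + (8 * r + 14 * r ^ 2 + 6 * r ^ 3) * l ^ 2
        + (6 * r + 11 * r ^ 2 + 6 * r ^ 3 + r ^ 4) * l ^ 4 := by
  obtain ⟨ν, hν, rfl⟩ := h
  have ht : |Real.arctan l| < Real.pi / 2 :=
    abs_lt.2 ⟨Real.neg_pi_div_two_lt_arctan l, Real.arctan_lt_pi_div_two l⟩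
  have hcos : 0 < Real.cos (Real.arctan l) := Real.cos_pos_of_mem_Ioo (abs_lt.1 ht)
  have hmem := mem_interior_integrableExpSet_of_isSymmetricGHS hν ht
  obtain ⟨e1, e2, e4⟩ := integral_pow_mul_exp_of_isSymmetricGHS hν _ ht
  rw [Real.tan_arctan] at e1 e2 e4
  have hC : 0 < Real.cos (Real.arctan l) ^ (-r) := Real.rpow_pos_of_pos hcos _
  have hint : ∀ g : ℝ → ℝ, ∫ x, g x ∂(ν.tilted fun x => Real.arctan l * x)
      = (∫ x, g x * Real.exp (Real.arctan l * x) ∂ν) / Real.cos (Real.arctan l) ^ (-r) := by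
    intro g
    have := integral_tilted_mul_eq_mgf (μ := ν) (X := id) (t := Real.arctan l) g
    simp only [id] at this
    rw [this, ← hν.2 _ ht, ← integral_div]
    refine integral_congr_ae (ae_of_all _ fun x => ?_)
    simp only [smul_eq_mul]
    ring
  refine ⟨?_, ?_, ?_, ?_⟩
  · have hexp : Integrable (fun x => Real.exp (Real.arctan l * x)) ν := by
      simpa [integrableExpSet] using interior_subset hmem
    rw [integrable_tilted_iff hexp]
    refine (integrable_pow_mul_exp_of_mem_interior_integrableExpSet hmem 4).congr
      (ae_of_all _ fun x => ?_)
    simp only [id, smul_eq_mul]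
    ring
  · rw [hint, e1]; field_simp
  · rw [hint, e2]; field_simp
  · rw [hint, e4]; field_simp

theorem momentBound_ghs {α τ η c : ℝ} (hα : 0 < α) (hc : 0 < c) (hcτ : c ≤ τ) {G : Measure ℝ}
    (h : IsGHS (τ * α) η G) :
    MomentBound (.ghs α) τ (α * η)
      (max (38 * (1 + 1 / (c * α)) ^ 3 * (1 + α ^ 4)) ((|(Family.ghs α).nu0| + |(Family.ghs α).nu1|
        + |(Family.ghs α).nu2|) / c))
      (G.map fun x : ℝ => x / τ) := by
  have hτ : 0 < τ := hc.trans_le hcτ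
  have hnu : (Family.ghs α).nu2 = 1 / α := rfl
  have hcτ' : c ≤ τ + (Family.ghs α).nu2 := by
    have : 0 < 1 / α := by positivity
    rw [hnu]; linarith
  obtain ⟨hi, m1, m2, m4⟩ := integral_pow_of_isGHS h
  exact
  { pos := hτ
    pos' := hc.trans_le hcτ'
    integrable := by
      rw [integrable_map_measure (by fun_prop) (by fun_prop)]
      simpa [Function.comp_def, div_pow] using hi.div_const (τ ^ 4)
    mean := by
      rw [integral_map (by fun_prop) (by fun_prop), integral_div, m1]
      field_simp
    second := by
      rw [integral_map (by fun_prop) (by fun_prop)]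
      simp only [div_pow]
      rw [integral_div, m2]
      simp only [Family.V, Family.nu0, Family.nu1, Family.nu2]
      field_simp; ring
    fourth := by
      rw [integral_map (by fun_prop) (by fun_prop)]
      simp only [div_pow]
      rw [integral_div, m4, div_le_iff₀ (by positivity)]
      set W := 1 + 1 / (c * α) with hW
      set r := τ * α with hr
      have hr0 : 0 < r := by positivity
      have hcα : 0 < 1 / (c * α) := by positivity
      have hW1 : 1 ≤ W := by rw [hW]; linarith
      have hWr : 1 ≤ W * r := by
        have : 1 ≤ 1 / (c * α) * r := by
          rw [div_mul_eq_mul_div, le_div_iff₀ (by positivity), hr]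
          nlinarith
        rw [hW]; nlinarith
      have b3 : r ^ 3 ≤ W ^ 3 * r ^ 4 := by
        calc r ^ 3 ≤ r ^ 3 * (W * r) := le_mul_of_one_le_right (by positivity) hWr
          _ = W * r ^ 4 := by ring
          _ ≤ W ^ 3 * r ^ 4 := by gcongr; exact le_self_pow₀ hW1 (by norm_num)
      have b2 : r ^ 2 ≤ W ^ 3 * r ^ 4 := by
        calc r ^ 2 ≤ r ^ 2 * (W * r) ^ 2 :=
              le_mul_of_one_le_right (by positivity) (one_le_pow₀ hWr)
          _ = W ^ 2 * r ^ 4 := by ring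
          _ ≤ W ^ 3 * r ^ 4 := by gcongr; norm_num
      have b1 : r ≤ W ^ 3 * r ^ 4 := by
        calc r ≤ r * (W * r) ^ 3 := le_mul_of_one_le_right (by positivity) (one_le_pow₀ hWr)
          _ = W ^ 3 * r ^ 4 := by ring
      have b4 : r ^ 4 ≤ W ^ 3 * r ^ 4 := le_mul_of_one_le_left (by positivity) (one_le_pow₀ hW1)
      set B := W ^ 3 * r ^ 4 with hB
      have hB0 : 0 ≤ B := by positivity
      -- Every `r ^ j` with `1 ≤ j ≤ 4` is at most `B`, so 5, 28 and 24 are the coefficient sums.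
      -- Then `28η² ≤ 14 + 14η⁴` gives 38.
      calc (2 * r + 3 * r ^ 2) + (8 * r + 14 * r ^ 2 + 6 * r ^ 3) * η ^ 2
            + (6 * r + 11 * r ^ 2 + 6 * r ^ 3 + r ^ 4) * η ^ 4
          ≤ 5 * B + 28 * B * η ^ 2 + 24 * B * η ^ 4 := by
            gcongr <;> linarith
        _ ≤ 38 * B * (1 + η ^ 4) := by
            nlinarith [mul_nonneg hB0 (sq_nonneg (η ^ 2 - 1))]
        _ = 38 * W ^ 3 * (α ^ 4 + (α * η) ^ 4) * τ ^ 4 := by rw [hB, hr]; ring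
        _ ≤ 38 * W ^ 3 * ((1 + α ^ 4) * (1 + (α * η) ^ 4)) * τ ^ 4 := by
            gcongr
            nlinarith [show 0 ≤ α ^ 4 * (α * η) ^ 4 by positivity]
        _ = (38 * W ^ 3 * (1 + α ^ 4)) * (1 + (α * η) ^ 4) * τ ^ 4 := by ring
        _ ≤ _ := by
            gcongr
            exact le_max_left _ _
    variance_le := fun y => (abs_V_div_le _ hc hcτ' y).trans (by gcongr; exact le_max_right _ _)
    support := ae_of_all _ fun x => Set.mem_univ x }

end GHS

/-! ### The five families -/

theorem isBigO_sum_abs_pow_three {x : ℕ → ℝ} (a : ℝ)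
    (h : (fun p : ℕ => ∑ i ∈ Finset.range p, x i ^ 4) =O[atTop] fun p : ℕ => (p : ℝ)) :
    (fun p : ℕ => ∑ i ∈ Finset.range p, |a * x i| ^ 3) =O[atTop] fun p : ℕ => (p : ℝ) := by
  refine Asymptotics.IsBigO.trans (Asymptotics.isBigO_of_le' (c := |a| ^ 3) _ fun p => ?_)
    ((Asymptotics.isBigO_refl _ _).add h)
  rw [Real.norm_of_nonneg (Finset.sum_nonneg fun _ _ => by positivity), Real.norm_of_nonneg
    (add_nonneg (by positivity) (Finset.sum_nonneg fun _ _ => by positivity))]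
  calc ∑ i ∈ Finset.range p, |a * x i| ^ 3
      ≤ ∑ i ∈ Finset.range p, |a| ^ 3 * (1 + x i ^ 4) := by
        refine Finset.sum_le_sum fun i _ => ?_
        rw [abs_mul, mul_pow, ← Even.pow_abs (by decide : Even 4) (x i)]
        gcongr
        nlinarith [sq_nonneg (|x i| - 1), sq_nonneg (|x i| ^ 2 - |x i|), sq_nonneg (|x i| ^ 2 - 1)]
    _ = |a| ^ 3 * (p + ∑ i ∈ Finset.range p, x i ^ 4) := by
        rw [← Finset.mul_sum, Finset.sum_add_distrib, Finset.sum_const, Finset.card_range,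
          nsmul_eq_mul, mul_one]

theorem isBigO_sum_abs_pow_three_of_abs_le_one {x : ℕ → ℝ} (h : ∀ i, |x i| ≤ 1) :
    (fun p : ℕ => ∑ i ∈ Finset.range p, |x i| ^ 3) =O[atTop] fun p : ℕ => (p : ℝ) := by
  refine Asymptotics.isBigO_of_le _ fun p => ?_
  rw [Real.norm_of_nonneg (Finset.sum_nonneg fun _ _ => by positivity),
    Real.norm_of_nonneg (by positivity)]
  refine (Finset.sum_le_sum fun i _ => pow_le_one₀ (abs_nonneg _) (h i)).trans ?_
  simp

theorem momentBound_binomial {n : ℕ} (hn : 2 ≤ n) (q : unitInterval) :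
    MomentBound .binomial n q (max 1 ((|Family.binomial.nu0| + |Family.binomial.nu1|
        + |Family.binomial.nu2|) / 1))
      ((ProbabilityTheory.binomial n q).map fun k : ℕ => (k : ℝ) / n) := by
  have hn' : (2 : ℝ) ≤ n := by exact_mod_cast hn
  have hle : ∀ᵐ k ∂(ProbabilityTheory.binomial n q), k ≤ n :=
    ae_le_of_hasLaw_binomial (X := id) .id
  refine (isPanjer_binomial n q).momentBound rfl rfl (by linarith) one_pos
    (by simp only [Family.nu2]; linarith) ?_ ?_ measurableSet_Icc
  · have h1 : ∫ k : ℕ, (k : ℝ) ^ 4 ∂(ProbabilityTheory.binomial n q)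
        ≤ ∫ _ : ℕ, (n : ℝ) ^ 4 ∂(ProbabilityTheory.binomial n q) := by
      refine integral_mono_ae (integrable_binomial _) (integrable_const _) ?_
      filter_upwards [hle] with k hk
      gcongr
    simp only [integral_const, probReal_univ, one_smul] at h1
    have h2 : 0 ≤ (n : ℝ) ^ 4 * (q : ℝ) ^ 4 := by positivity
    linarith
  · filter_upwards [hle] with k hk
    refine ⟨by positivity, ?_⟩
    rw [div_le_one (by linarith)]
    exact_mod_cast hk

theorem momentBound_poisson {τ θ c : ℝ} (hc : 0 < c) (hcτ : c ≤ τ) (hθ : 0 < θ) :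
    MomentBound .poisson τ θ (max (600 * (1 + 1 / c) ^ 3) ((|Family.poisson.nu0|
        + |Family.poisson.nu1| + |Family.poisson.nu2|) / c))
      ((poissonMeasure (τ * θ).toNNReal).map fun k : ℕ => (k : ℝ) / τ) := by
  have hτ : 0 < τ := hc.trans_le hcτ
  have h := isPanjer_poisson hτ hθ
  have hc' : 0 < 1 / c := by positivity
  have hW : 1 ≤ (1 + 1 / c) * τ := by
    have : 1 ≤ 1 / c * τ := by rw [div_mul_eq_mul_div, le_div_iff₀ hc]; linarith
    linarith
  exact IsPanjer.momentBound (F := .poisson) h rfl rfl hτ hc (by simpa [Family.nu2] using hcτ)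
    (h.fourth_le hτ hθ.le zero_le_one (by linarith) hW)
    (ae_of_all _ fun k => Set.mem_Ici.2 (by positivity)) measurableSet_Ici

theorem momentBound_negBinomial {τ q c : ℝ} (hc : 0 < c) (hcτ : c ≤ τ) (hq : 0 < q) (hq1 : q < 1)
    (hprob : IsProbabilityMeasure (negBinomialMeasure τ q)) :
    MomentBound .negBinomial τ (q / (1 - q)) (max (600 * (1 + 1 / c) ^ 3)
      ((|Family.negBinomial.nu0| + |Family.negBinomial.nu1| + |Family.negBinomial.nu2|) / c))
      ((negBinomialMeasure τ q).map fun k : ℕ => (k : ℝ) / τ) := by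
  have hτ : 0 < τ := hc.trans_le hcτ
  have h1q : 0 < 1 - q := by linarith
  have h := isPanjer_negBinomial hτ hq hq1 hprob
  have hc' : 0 < 1 / c := by positivity
  have hW : 1 ≤ (1 + 1 / c) * τ := by
    have : 1 ≤ 1 / c * τ := by rw [div_mul_eq_mul_div, le_div_iff₀ hc]; linarith
    linarith
  exact IsPanjer.momentBound (F := .negBinomial) h rfl rfl hτ hc
    (by simp only [Family.nu2]; linarith)
    (h.fourth_le hτ (by positivity) le_rfl (by linarith) hW)
    (ae_of_all _ fun k => Set.mem_Ici.2 (by positivity)) measurableSet_Ici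

/-- The regularity conditions yield moment bounds that are uniform over the observations. -/
theorem exists_momentBound (F : Family) {τ η : ℕ → ℝ} {Q : ℕ → Measure ℝ}
    (hQ : ∀ i, IsProbabilityMeasure (Q i)) (hlaw : ∀ i, F.IsLaw (τ i) (η i) (Q i))
    (hcond : F.Conditions τ η) :
    (∃ K, ∀ i, MomentBound F (τ i) (F.mean (η i)) K (Q i)) ∧
      (fun p : ℕ => ∑ i ∈ Finset.range p, |F.mean (η i)| ^ 3) =O[atTop] fun p : ℕ => (p : ℝ) := by
  cases F with
  | binomial =>
    refine ⟨⟨max 1 ((|Family.binomial.nu0| + |Family.binomial.nu1| + |Family.binomial.nu2|) / 1),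
      fun i => ?_⟩, isBigO_sum_abs_pow_three_of_abs_le_one fun i => ?_⟩
    · obtain ⟨n, q, -, hτ, hη, hQi⟩ := hlaw i
      have hn : 2 ≤ n := by
        have := hcond i
        rw [hτ] at this
        exact_mod_cast this
      have := momentBound_binomial hn q
      rw [← hτ] at this
      simp only [Family.mean]
      rw [hQi, hη]
      exact this
    · obtain ⟨n, q, -, -, hη, -⟩ := hlaw i
      simp only [Family.mean, hη]
      rw [abs_of_nonneg q.2.1]
      exact q.2.2
  | poisson =>
    obtain ⟨⟨c, hc, hcτ⟩, -, hsum⟩ := hcond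
    refine ⟨⟨_, fun i => (hlaw i).2.2 ▸ momentBound_poisson hc (hcτ i) (hlaw i).2.1⟩, ?_⟩
    have : ∀ i, |Family.poisson.mean (η i)| = η i := fun i => abs_of_pos (hlaw i).2.1
    simpa only [this] using hsum
  | negBinomial =>
    obtain ⟨⟨c, hc, hcτ⟩, hsum⟩ := hcond
    -- Normalization of the masses is inherited from the law of `Y i`, so the negative binomial
    -- series is never summed.
    have hprob : ∀ i, IsProbabilityMeasure (negBinomialMeasure (τ i) (η i)) := fun i => by
      have := hQ i
      rw [(hlaw i).2.2.2] at this
      exact Measure.isProbabilityMeasure_of_map fun k : ℕ => (k : ℝ) / τ i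
    have hτ : ∀ i, c ≤ τ i := fun i =>
      (hcτ i).trans (mul_le_of_le_one_right (hlaw i).1.le (hlaw i).2.2.1.le)
    refine ⟨⟨_, fun i => (hlaw i).2.2.2 ▸
      momentBound_negBinomial hc (hτ i) (hlaw i).2.1 (hlaw i).2.2.1 (hprob i)⟩, ?_⟩
    simpa [Family.mean] using isBigO_sum_abs_pow_three 1 hsum
  | gamma α =>
    obtain ⟨⟨c, hc, hcτ⟩, hsum⟩ := hcond
    exact ⟨⟨_, fun i => (hlaw i).2.2.2 ▸
      momentBound_gamma (hlaw i).1 (hlaw i).2.2.1 hc (hcτ i)⟩, isBigO_sum_abs_pow_three α hsum⟩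
  | ghs α =>
    obtain ⟨⟨c, hc, hcτ⟩, hsum⟩ := hcond
    choose hα hτ G hG hQG using hlaw
    exact ⟨⟨_, fun i => hQG i ▸ momentBound_ghs (hα i) hc (hcτ i) (hG i)⟩,
      isBigO_sum_abs_pow_three α hsum⟩

end NEFQVF

end

theorem theorem6 {Ω : Type*} [MeasurableSpace Ω] (P : Measure Ω) [IsProbabilityMeasure P]
    (F : NEFQVF.Family) (τ η θ : ℕ → ℝ) (Y : ℕ → Ω → ℝ)
    (hYm : ∀ i, Measurable (Y i)) (hYind : iIndepFun Y P)
    (hYlaw : ∀ i, F.IsLaw (τ i) (η i) (P.map (Y i)))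
    (hθ : ∀ i, θ i = F.mean (η i))
    (hcond : F.Conditions τ η)
    (γPM : ℕ → Ω → ℝ≥0∞) (μPM : ℕ → Ω → ℝ)
    (hγPM : ∀ p, Measurable (γPM p)) (hμPM : ∀ p, Measurable (μPM p))
    (hPM : ∀ p, 0 < p → ∀ᵐ ω ∂P,
      NEFQVF.IsUREMinimizer F p τ (fun i => Y i ω) (γPM p ω) (μPM p ω))
    (γ : ℕ → Ω → ℝ≥0∞) (μ : ℕ → Ω → ℝ)
    (hγ : ∀ p, Measurable (γ p)) (hμ : ∀ p, Measurable (μ p))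
    (hμmax : ∀ p, 0 < p → ∀ᵐ ω ∂P, |μ p ω| ≤ NEFQVF.maxAbs p (fun i => Y i ω)) :
    (∀ ε : ℝ, 0 < ε →
      Tendsto (fun p : ℕ => P {ω |
        NEFQVF.randomLoss p θ τ Y (γPM p) (μPM p) ω ≥
          NEFQVF.randomLoss p θ τ Y (γ p) (μ p) ω + ε}) atTop (𝓝 0)) ∧
    (∀ p, 0 < p →
      Integrable (NEFQVF.randomLoss p θ τ Y (γPM p) (μPM p)) P ∧
      Integrable (NEFQVF.randomLoss p θ τ Y (γ p) (μ p)) P) ∧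
    limsup (fun p : ℕ =>
      ((NEFQVF.risk P p θ τ Y (γPM p) (μPM p) - NEFQVF.risk P p θ τ Y (γ p) (μ p) : ℝ) : EReal))
      atTop ≤ 0 := by
  obtain ⟨⟨K, hK⟩, hsum⟩ := NEFQVF.exists_momentBound F
    (fun i => Measure.isProbabilityMeasure_map (hYm i).aemeasurable) hYlaw hcond
  simp only [← hθ] at hK hsum
  exact NEFQVF.asymptotic_optimality hYm hYind hK hsum hγPM hμPM hPM hγ hμ hμmax
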